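/- **Setting.** Let $(X_p)_{p\ge 0}$ be a Markov chain with $X_p$ taking values in a measurable space $(E_p,\mathcal E_p)$, with fixed initial value $X_0=x_0$ and Markov transitions $K_p(x_{p-1},dx_p)$, $p\ge 1$. Write $F_p=E_0\times\dots\times E_p$ and $Y_p=(X_0,\dots,X_p)\in F_p$, and let $M_p(y_{p-1},dy_p)$ be the transitions of $Y_p$, so that a path $y_{p-1}=(x_0,\dots,x_{p-1})$ is kept and extended by a point sampled from $K_p(x_{p-1},\cdot)$. Let $\mathcal B_b(F)$ be the set of bounded measurable real functions on $F$. Fix $n\ge 1$, a measurable $V_n:E_n\to\mathbb R$ and $a\in\mathbb R$ with $P_n(a):=\mathbb P(V_n(X_n)\ge a)>0$. Let $G_k:F_k\to(0,\infty)$, $1\le k<n$, be measurable with $\sup_{y,y'\in F_k}G_k(y)/G_k(y')<\infty$, and put $G_k^-=1/G_k$. For $1\le p\le n$ set $$\gamma_p(f)=\mathbb E\Big[f(Y_p)\prod_{1\le k<p}G_k(Y_k)\Big],\qquad \eta_p(f)=\gamma_p(f)/\gamma_p(1),$$ and let $\gamma_p^-,\eta_p^-$ be defined in the same way with $G_k^-$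 in place of $G_k$. For $\varphi\in\mathcal B_b(F_n)$ put $$T_n^{(a)}(\varphi)(x_0,\dots,x_n)=\varphi(x_0,\dots,x_n)\,\mathbf 1_{V_n(x_n)\ge a}\prod_{1\le k<n}G_k^-(x_0,\dots,x_k),\qquad P_n(a,\varphi)=\mathbb E[\varphi(X_0,\dots,X_n)\mid V_n(X_n)\ge a].$$ **Particle model.** For a probability measure $\eta$ on $F_{p}$ let $\Phi_{p+1}(\eta)=\eta(G_p)^{-1}\int\eta(dy)\,G_p(y)\,M_{p+1}(y,\cdot)$. For each $N\ge1$ let $\xi_p=(\xi_p^i)_{1\le i\le N}\in F_p^N$, $1\le p\le n$, be such that $\xi_1^1,\dots,\xi_1^N$ are independent with common law $M_1(x_0,\cdot)$ and, for $1\le p<n$, conditionally on $(\xi_1,\dots,\xi_p)$ the variables $\xi_{p+1}^1,\dots,\xi_{p+1}^N$ are independent with common law $\Phi_{p+1}(\eta_p^N)$, where $\eta_p^N=\frac1N\sum_{i=1}^N\delta_{\xi_p^i}$. Define $$P_n^N(a)=\eta_n^N(T_n^{(a)}(1))\prod_{1\le p<n}\eta_p^N(G_p),\qquad P_n^N(a,\varphi)=\frac{\eta_n^N(T_n^{(a)}(\varphi))}{\eta_n^N(T_n^{(a)}(1))},$$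 with the convention $P_n^N(a,\varphi)=0$ when the denominator vanishes. **Theorem 2.3.** (i) For every $N\ge1$ the estimator $P_n^N(a)$ is integrable and unbiased: $\mathbb E[P_n^N(a)]=P_n(a)$. (ii) As $N\to\infty$, $\sqrt N\,[P_n^N(a)-P_n(a)]$ converges in law to $\mathcal N(0,\sigma_n^\gamma(a)^2)$, where $$\sigma_n^\gamma(a)^2=\sum_{p=1}^n\Big[\gamma_p(1)\,\gamma_p^-(1)\,\eta_p^-\big(P_{p,n}(a)^2\big)-P_n(a)^2\Big],\qquad P_{p,n}(a)(x_p)=\mathbb E[\mathbf 1_{V_n(X_n)\ge a}\mid X_p=x_p],$$ and $P_{p,n}(a)$ is regarded as a function on $F_p$ through the last coordinate $x_p$. (iii) For every $\varphi_n\in\mathcal B_b(F_n)$, as $N\to\infty$, $\sqrt N\,[P_n^N(a,\varphi_n)-P_n(a,\varphi_n)]$ converges in law to $\mathcal N(0,\sigma_n(a,\varphi_n)^2)$, where $$\sigma_n(a,\varphi_n)^2=P_n(a)^{-2}\sum_{p=1}^n\gamma_p(1)\,\gamma_p^-(1)\,\eta_p^-\big(P_{p,n}(a,\varphi_n)^2\big),$$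 $$P_{p,n}(a,\varphi_n)(x_0,\dots,x_p)=\mathbb E\big[(\varphi_n(X_0,\dots,X_n)-P_n(a,\varphi_n))\,\mathbf 1_{V_n(X_n)\ge a}\,\big|\,(X_0,\dots,X_p)=(x_0,\dots,x_p)\big].$$ Here $\mathcal N(0,0)$ is the point mass at $0$, and the conditional expectations in (ii) and (iii) may be any measurable versions. -/

import Mathlib

open MeasureTheory ProbabilityTheory Filter Preorder
open scoped ENNReal NNReal Topology

namespace RareEvent

universe u v

/-- The path space `F_p = E_0 × ⋯ × E_p`. -/
abbrev Path (E : ℕ → Type u) (p : ℕ) : Type u := (i : Finset.Iic p) → E i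

/-- The end point `x_p` of a path `(x_0, …, x_p)`. -/
def endpoint {E : ℕ → Type u} {p : ℕ} (y : Path E p) : E p := y ⟨p, Finset.mem_Iic.2 le_rfl⟩

section Chain

variable {E : ℕ → Type u} [∀ p, MeasurableSpace (E p)]

/-- The path of length zero consisting of the initial point. -/
def initPath (x₀ : E 0) : Path E 0 :=
  (MeasurableEquiv.piUnique (fun i : Finset.Iic 0 => E i)).symm x₀

lemma measurable_endpoint (p : ℕ) : Measurable (endpoint : Path E p → E p) :=
  measurable_pi_apply _

/-- The transition `x_p ↦ x_{p+1}` of the Markov chain, seen as a kernel on the whole past; it only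
looks at the end point of the past. -/
noncomputable def stepKernel (K : (p : ℕ) → Kernel (E p) (E (p + 1))) (p : ℕ) :
    Kernel (Path E p) (E (p + 1)) :=
  (K p).comap endpoint (measurable_endpoint p)

instance (K : (p : ℕ) → Kernel (E p) (E (p + 1))) [∀ p, IsMarkovKernel (K p)] (p : ℕ) :
    IsMarkovKernel (stepKernel K p) := by
  unfold stepKernel; infer_instance

/-- The transition of the historical process `Y_p = (X_0, …, X_p)` from time `p` to `p + 1`:
the path `y` is kept and extended by a `K p`-transition from its end point. -/
noncomputable def histKernel (K : (p : ℕ) → Kernel (E p) (E (p + 1))) (p : ℕ) :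
    Kernel (Path E p) (Path E (p + 1)) :=
  Kernel.partialTraj (stepKernel K) p (p + 1)

/-- The law on `∏ p, E p` of the Markov chain `X` started at `x₀` with transitions `K`. The chain
itself is the coordinate process `X_p x = x p`, and `Y_p x = frestrictLe p x`. -/
noncomputable def chainLaw (K : (p : ℕ) → Kernel (E p) (E (p + 1))) [∀ p, IsMarkovKernel (K p)]
    (x₀ : E 0) : Measure ((p : ℕ) → E p) :=
  Kernel.traj (stepKernel K) 0 (initPath x₀)

end Chain

/-- Admissible potentials: measurable, positive, with bounded ratios `g y / g y'`. -/
structure IsRegularPotential {F : Type u} [MeasurableSpace F] (g : F → ℝ) : Prop where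
  measurable : Measurable g
  pos : ∀ y, 0 < g y
  bounded_ratio : ∃ C : ℝ, ∀ y y', g y / g y' ≤ C

/-- `∏_{1 ≤ k < p} G_k(x_0, …, x_k)` for a path `(x_0, …, x_p)`. -/
noncomputable def pathWeight {E : ℕ → Type u} (G : (k : ℕ) → Path E k → ℝ) (p : ℕ)
    (y : Path E p) : ℝ :=
  ∏ k ∈ (Finset.Ico 1 p).attach,
    G k.1 (frestrictLe₂ (π := E) (Finset.mem_Ico.1 k.2).2.le y)

/-- The inverse potentials `G_k⁻ = 1 / G_k`. -/
noncomputable def invPotential {E : ℕ → Type u} (G : (k : ℕ) → Path E k → ℝ) :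
    (k : ℕ) → Path E k → ℝ :=
  fun k y => 1 / G k y

section FeynmanKac

variable {E : ℕ → Type u} [∀ p, MeasurableSpace (E p)]
  (K : (p : ℕ) → Kernel (E p) (E (p + 1))) [∀ p, IsMarkovKernel (K p)]
  (x₀ : E 0) (G : (k : ℕ) → Path E k → ℝ)

/-- `γ_p(f) = 𝔼[f(Y_p) ∏_{1 ≤ k < p} G_k(Y_k)]`. -/
noncomputable def gammaFlow (p : ℕ) (f : Path E p → ℝ) : ℝ :=
  ∫ x, f (frestrictLe p x) * pathWeight G p (frestrictLe p x) ∂(chainLaw K x₀)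

/-- `η_p(f) = γ_p(f) / γ_p(1)`. -/
noncomputable def etaFlow (p : ℕ) (f : Path E p → ℝ) : ℝ :=
  gammaFlow K x₀ G p f / gammaFlow K x₀ G p (fun _ => 1)

/-- `P_n(a) = ℙ(V(X_n) ≥ a)`. -/
noncomputable def rareProb (n : ℕ) (V : E n → ℝ) (a : ℝ) : ℝ :=
  (chainLaw K x₀).real {x | a ≤ V (x n)}

/-- `P_n(a, φ) = 𝔼[φ(X_0, …, X_n) | V(X_n) ≥ a]`. -/
noncomputable def rareMean (n : ℕ) (V : E n → ℝ) (a : ℝ) (φ : Path E n → ℝ) : ℝ :=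
  ∫ x, φ (frestrictLe n x) ∂((chainLaw K x₀)[|{x | a ≤ V (x n)}])

end FeynmanKac

open Classical in
/-- `T_n^{(a)}(φ)(x_0, …, x_n) = φ(x_0, …, x_n) 1_{V(x_n) ≥ a} ∏_{1 ≤ k < n} G_k⁻(x_0, …, x_k)`. -/
noncomputable def weightedIndicator {E : ℕ → Type u} (G : (k : ℕ) → Path E k → ℝ) (n : ℕ)
    (V : E n → ℝ) (a : ℝ) (φ : Path E n → ℝ) (y : Path E n) : ℝ :=
  φ y * (if a ≤ V (endpoint y) then 1 else 0) * pathWeight (invPotential G) n y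

/-- `g` is a version of the function `b ↦ 𝔼[Z | X = b]`. -/
def IsCondExpGiven {Ω : Type u} {β : Type v} [MeasurableSpace Ω] [mβ : MeasurableSpace β]
    (μ : Measure Ω) (Z : Ω → ℝ) (X : Ω → β) (g : β → ℝ) : Prop :=
  Measurable g ∧ (fun ω => g (X ω)) =ᵐ[μ] μ[Z | mβ.comap X]

section Particles

/-- The empirical measure `m(y) = N⁻¹ ∑ i, δ_{y^i}`. -/
noncomputable def empMeasure {F : Type u} [MeasurableSpace F] {N : ℕ} (y : Fin N → F) :
    Measure F :=
  (N : ℝ≥0∞)⁻¹ • ∑ i, Measure.dirac (y i)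

/-- The integral `m(y)(f) = N⁻¹ ∑ i, f(y^i)` of a function for the empirical measure. -/
noncomputable def empMean {F : Type u} {N : ℕ} (y : Fin N → F) (f : F → ℝ) : ℝ :=
  (N : ℝ)⁻¹ * ∑ i, f (y i)

variable {E : ℕ → Type u} [∀ p, MeasurableSpace (E p)]

/-- The map `Φ_{p+1}(η) = ∫ η(dy) G_p(y) M_{p+1}(y, ·) / η(G_p)` from measures on `F_p` to measures
on `F_{p+1}`. -/
noncomputable def fkMap (K : (p : ℕ) → Kernel (E p) (E (p + 1))) (G : (k : ℕ) → Path E k → ℝ)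
    (p : ℕ) (η : Measure (Path E p)) : Measure (Path E (p + 1)) :=
  (∫⁻ y, ENNReal.ofReal (G p y) ∂η)⁻¹ •
    (η.withDensity (fun y => ENNReal.ofReal (G p y))).bind (histKernel K p)

/-- `(ξ_p)_{1 ≤ p ≤ n}` is the genealogical `N`-particle model up to time `n` on the probability
space `(Ω, μ)`: `ξ_1` consists of `N` independent variables with law `M_1(x₀, ·)`, and
conditionally on `(ξ_1, …, ξ_p)` the `N` components of `ξ_{p+1}` are independent with common law
`Φ_{p+1}(m(ξ_p))`. The values of `ξ` at other times play no role. -/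
structure IsParticleModel (K : (p : ℕ) → Kernel (E p) (E (p + 1))) (x₀ : E 0)
    (G : (k : ℕ) → Path E k → ℝ) (n N : ℕ) {Ω : Type v} [MeasurableSpace Ω] (μ : Measure Ω)
    (ξ : (p : ℕ) → Ω → Fin N → Path E p) : Prop where
  measurable : ∀ p, 1 ≤ p → p ≤ n → Measurable (ξ p)
  initial : μ.map (ξ 1) = Measure.pi (fun _ : Fin N => histKernel K 0 (initPath x₀))
  transition : ∀ p, 1 ≤ p → p < n →
    ∀ f : ((q : Finset.Icc 1 p) → Fin N → Path E q) × (Fin N → Path E (p + 1)) → ℝ≥0∞,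
      Measurable f →
      ∫⁻ ω, f (fun q => ξ q ω, ξ (p + 1) ω) ∂μ =
        ∫⁻ ω, ∫⁻ y, f (fun q => ξ q ω, y)
          ∂(Measure.pi (fun _ : Fin N => fkMap K G p (empMeasure (ξ p ω)))) ∂μ

/-- The estimator `P_n^N(a) = η_n^N(T_n^{(a)}(1)) ∏_{1 ≤ p < n} η_p^N(G_p)`. -/
noncomputable def probEstimator (G : (k : ℕ) → Path E k → ℝ) (n : ℕ) (V : E n → ℝ) (a : ℝ)
    {N : ℕ} {Ω : Type v} (ξ : (p : ℕ) → Ω → Fin N → Path E p) (ω : Ω) : ℝ :=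
  empMean (ξ n ω) (weightedIndicator G n V a (fun _ => 1)) *
    ∏ p ∈ Finset.Ico 1 n, empMean (ξ p ω) (G p)

/-- The estimator `P_n^N(a, φ) = η_n^N(T_n^{(a)}(φ)) / η_n^N(T_n^{(a)}(1))`; it is `0` when the
denominator vanishes. -/
noncomputable def condEstimator (G : (k : ℕ) → Path E k → ℝ) (n : ℕ) (V : E n → ℝ) (a : ℝ)
    (φ : Path E n → ℝ) {N : ℕ} {Ω : Type v} (ξ : (p : ℕ) → Ω → Fin N → Path E p) (ω : Ω) : ℝ :=
  empMean (ξ n ω) (weightedIndicator G n V a φ) /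
    empMean (ξ n ω) (weightedIndicator G n V a (fun _ => 1))

end Particles

end RareEvent

/-! Everything rests on the unnormalized particle estimates γ_p^N(f) (`gammaEst`), which have a
one-step structure. Given the particles up to time p, γ_{p+1}^N(f) is γ_p^N(G_p) times an empirical
mean of N independent variables with law Φ_{p+1}(η_p^N). The normalization of Φ cancels, so its
conditional mean is γ_p^N(Qf) with Qf = G_p M_{p+1}(f) (`pastEst_mul_integral_fkKernel`). The exact
flow obeys the same recursion, γ_{p+1}(f) = γ_p(Qf) (`gammaFlow_succ`). Induction on p, with f
replaced by Qf, then gives unbiasedness.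

For the fluctuations, the error at time p+1 is a conditionally centered sampling error plus the
error of γ_p^N(Qf). The characteristic function of √N times the sampling error is, conditionally on
the past, within O(1/√N) of a Gaussian one, uniformly in the sampling law
(`norm_integral_cexp_empMean_sub_le`). Its random variance γ_p^N(G_p) γ_p^N(Q(f²)) - γ_p^N(Qf)²
converges in mean to a constant, by the mean square bounds of `exists_integral_sq_gammaEst_sub_le`.
Each generation therefore multiplies the limiting characteristic function by a deterministic
Gaussian factor, and the variances add up to `asympVar` (`tendsto_integral_cexp_gammaEst`). Lévy's
continuity theorem finishes the argument.

The variance becomes explicit because the test functions have the form ψ ∏ G_k⁻. Applying Q to such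
a function removes the last inverse potential and replaces ψ by its conditional expectation
(`fkStep_mul_inv`), and squaring turns γ into γ⁻ (`gammaFlow_sq_mul_inv`). For the ratio estimator,
centering φ at m = P_n(a, φ) makes the numerator a centered γ_n^N estimate; the ratio is compared
with its linearization through second moments (`norm_cexp_ratio_sub_le`). -/

namespace RareEvent

universe u v

/-! ### Bounded measurable functions and admissible potentials. -/

/-- Bounded measurable real functions. -/
structure IsBddMeas {F : Type*} [MeasurableSpace F] (f : F → ℝ) : Prop where
  measurable : Measurable f
  bounded : ∃ C : ℝ, ∀ y, |f y| ≤ C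

namespace IsBddMeas

variable {F F' : Type*} [MeasurableSpace F] [MeasurableSpace F'] {f g : F → ℝ}

lemma exists_bound (hf : IsBddMeas f) : ∃ C : ℝ, 0 ≤ C ∧ ∀ y, |f y| ≤ C := by
  obtain ⟨C, hC⟩ := hf.bounded
  exact ⟨max C 0, le_max_right _ _, fun y => (hC y).trans (le_max_left _ _)⟩

lemma const (c : ℝ) : IsBddMeas (fun _ : F => c) := ⟨measurable_const, |c|, fun _ => le_rfl⟩

lemma mul (hf : IsBddMeas f) (hg : IsBddMeas g) : IsBddMeas (fun y => f y * g y) := by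
  obtain ⟨C, hC0, hC⟩ := hf.exists_bound
  obtain ⟨D, hD0, hD⟩ := hg.exists_bound
  refine ⟨hf.measurable.mul hg.measurable, C * D, fun y => ?_⟩
  rw [abs_mul]
  exact mul_le_mul (hC y) (hD y) (abs_nonneg _) hC0

lemma add (hf : IsBddMeas f) (hg : IsBddMeas g) : IsBddMeas (fun y => f y + g y) := by
  obtain ⟨C, hC0, hC⟩ := hf.exists_bound
  obtain ⟨D, hD0, hD⟩ := hg.exists_bound
  exact ⟨hf.measurable.add hg.measurable, C + D,
    fun y => (abs_add_le _ _).trans (add_le_add (hC y) (hD y))⟩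

lemma sub (hf : IsBddMeas f) (hg : IsBddMeas g) : IsBddMeas (fun y => f y - g y) := by
  obtain ⟨C, hC0, hC⟩ := hf.exists_bound
  obtain ⟨D, hD0, hD⟩ := hg.exists_bound
  exact ⟨hf.measurable.sub hg.measurable, C + D,
    fun y => (abs_sub _ _).trans (add_le_add (hC y) (hD y))⟩

lemma pow (hf : IsBddMeas f) (k : ℕ) : IsBddMeas (fun y => f y ^ k) := by
  obtain ⟨C, hC0, hC⟩ := hf.exists_bound
  refine ⟨hf.measurable.pow_const k, C ^ k, fun y => ?_⟩
  rw [abs_pow]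
  exact pow_le_pow_left₀ (abs_nonneg _) (hC y) k

lemma prod {ι : Type*} (s : Finset ι) {f : ι → F → ℝ} (hf : ∀ i ∈ s, IsBddMeas (f i)) :
    IsBddMeas (fun y => ∏ i ∈ s, f i y) := by
  classical
  induction s using Finset.induction_on with
  | empty => simpa using const 1
  | insert i s his ih =>
    simp_rw [Finset.prod_insert his]
    exact (hf i (Finset.mem_insert_self _ _)).mul
      (ih fun j hj => hf j (Finset.mem_insert_of_mem hj))

lemma comp (hf : IsBddMeas f) {h : F' → F} (hh : Measurable h) : IsBddMeas (fun y => f (h y)) := by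
  obtain ⟨C, hC⟩ := hf.bounded
  exact ⟨hf.measurable.comp hh, C, fun y => hC _⟩

lemma integrable (hf : IsBddMeas f) (μ : Measure F) [IsFiniteMeasure μ] : Integrable f μ := by
  obtain ⟨C, hC⟩ := hf.bounded
  exact Integrable.of_bound hf.measurable.aestronglyMeasurable C (ae_of_all _ hC)

lemma abs_integral_le {C : ℝ} (hC : ∀ y, |f y| ≤ C) (μ : Measure F) [IsProbabilityMeasure μ] :
    |∫ y, f y ∂μ| ≤ C := by
  simpa using norm_integral_le_of_norm_le_const (μ := μ) (f := f) (ae_of_all _ hC)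

lemma integral_kernel (hf : IsBddMeas f) (κ : Kernel F' F) [IsMarkovKernel κ] :
    IsBddMeas (fun y => ∫ z, f z ∂κ y) := by
  obtain ⟨C, hC⟩ := hf.bounded
  exact ⟨(hf.measurable.stronglyMeasurable.integral_kernel (κ := κ)).measurable, C,
    fun y => abs_integral_le hC _⟩

end IsBddMeas

lemma IsRegularPotential.isBddMeas {F : Type u} [MeasurableSpace F] {g : F → ℝ}
    (hg : IsRegularPotential g) : IsBddMeas g := by
  obtain ⟨C, hC⟩ := hg.bounded_ratio
  rcases isEmpty_or_nonempty F with h | ⟨⟨y₀⟩⟩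
  · exact ⟨hg.measurable, 0, fun y => h.elim y⟩
  · refine ⟨hg.measurable, C * g y₀, fun y => ?_⟩
    rw [abs_of_pos (hg.pos y)]
    exact (div_le_iff₀ (hg.pos y₀)).1 (hC y y₀)

lemma IsRegularPotential.one_div {F : Type u} [MeasurableSpace F] {g : F → ℝ}
    (hg : IsRegularPotential g) : IsRegularPotential (fun y => 1 / g y) := by
  obtain ⟨C, hC⟩ := hg.bounded_ratio
  refine ⟨measurable_const.div hg.measurable, fun y => one_div_pos.2 (hg.pos y), C,
    fun y y' => ?_⟩
  simpa [div_eq_mul_inv, mul_comm] using hC y' y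

/-! ### Products of potentials along a path. -/

section Weights

variable {E : ℕ → Type u} {G : (k : ℕ) → Path E k → ℝ}

lemma pathWeight_succ (G : (k : ℕ) → Path E k → ℝ) {p : ℕ} (hp : 1 ≤ p) (y : Path E (p + 1)) :
    pathWeight G (p + 1) y =
      pathWeight G p (frestrictLe₂ p.le_succ y) * G p (frestrictLe₂ p.le_succ y) := by
  -- The product in `pathWeight` runs over an attached set that depends on q. Rewriting it over
  -- plain indices, with a junk value 1 outside the range, lets the last factor be split off.
  have key : ∀ q, ∀ hq : q ≤ p + 1, pathWeight G q (frestrictLe₂ (π := E) hq y) =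
      ∏ k ∈ Finset.Ico 1 q, if h : k ≤ p + 1 then G k (frestrictLe₂ (π := E) h y) else 1 := by
    intro q hq
    rw [pathWeight, ← Finset.prod_attach (Finset.Ico 1 q)]
    refine Finset.prod_congr rfl fun k _ => ?_
    rw [dif_pos ((Finset.mem_Ico.1 k.2).2.le.trans hq)]
    rfl
  have h1 := key (p + 1) le_rfl
  rw [Finset.prod_Ico_succ_top hp, dif_pos p.le_succ, ← key p p.le_succ] at h1
  exact h1

lemma pathWeight_one (G : (k : ℕ) → Path E k → ℝ) (y : Path E 1) : pathWeight G 1 y = 1 :=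
  Finset.prod_eq_one fun k _ => absurd (Finset.mem_Ico.1 k.2).1 (Finset.mem_Ico.1 k.2).2.not_ge

lemma pathWeight_pos {p : ℕ} (hG : ∀ k, 1 ≤ k → k < p → ∀ y, 0 < G k y) (y : Path E p) :
    0 < pathWeight G p y :=
  Finset.prod_pos fun k _ => hG k.1 (Finset.mem_Ico.1 k.2).1 (Finset.mem_Ico.1 k.2).2 _

lemma pathWeight_mul_invPotential {p : ℕ} (hG : ∀ k, 1 ≤ k → k < p → ∀ y, 0 < G k y)
    (y : Path E p) : pathWeight G p y * pathWeight (invPotential G) p y = 1 := by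
  rw [pathWeight, pathWeight, ← Finset.prod_mul_distrib]
  refine Finset.prod_eq_one fun k _ => ?_
  exact mul_one_div_cancel (hG k.1 (Finset.mem_Ico.1 k.2).1 (Finset.mem_Ico.1 k.2).2 _).ne'

variable [∀ p, MeasurableSpace (E p)]

lemma isBddMeas_pathWeight {p : ℕ} (hG : ∀ k, 1 ≤ k → k < p → IsRegularPotential (G k)) :
    IsBddMeas (pathWeight G p) :=
  IsBddMeas.prod _ fun k _ =>
    ((hG k.1 (Finset.mem_Ico.1 k.2).1 (Finset.mem_Ico.1 k.2).2).isBddMeas).comp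
      (measurable_frestrictLe₂ _)

lemma isRegularPotential_invPotential {n : ℕ}
    (hG : ∀ k, 1 ≤ k → k < n → IsRegularPotential (G k)) :
    ∀ k, 1 ≤ k → k < n → IsRegularPotential (invPotential G k) :=
  fun k h1 h2 => (hG k h1 h2).one_div

end Weights

/-! ### The historical process and the Feynman–Kac flow. -/

section Chain

variable {E : ℕ → Type u} [∀ p, MeasurableSpace (E p)]
  (K : (p : ℕ) → Kernel (E p) (E (p + 1))) [∀ p, IsMarkovKernel (K p)] (x₀ : E 0)

instance (p : ℕ) : IsMarkovKernel (histKernel K p) := by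
  unfold histKernel; infer_instance

instance : IsProbabilityMeasure (chainLaw K x₀) := by
  unfold chainLaw; infer_instance

/-- The law of the path `Y_p`. -/
noncomputable def pathLaw (p : ℕ) : Measure (Path E p) :=
  Kernel.partialTraj (stepKernel K) 0 p (initPath x₀)

instance (p : ℕ) : IsProbabilityMeasure (pathLaw K x₀ p) := by
  unfold pathLaw; infer_instance

lemma integral_chainLaw {p : ℕ} {f : Path E p → ℝ} (hf : Measurable f) :
    ∫ x, f (frestrictLe p x) ∂chainLaw K x₀ = ∫ y, f y ∂pathLaw K x₀ p := by
  rw [pathLaw, ← Kernel.traj_map_frestrictLe_apply, chainLaw,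
    integral_map (by fun_prop) hf.aestronglyMeasurable]

/-- Tower property: the law up to time q is the law up to time p followed by the transition from p
to q. -/
lemma integral_pathLaw_partialTraj {p q : ℕ} (hpq : p ≤ q) {f : Path E q → ℝ} (hf : IsBddMeas f) :
    ∫ y, f y ∂pathLaw K x₀ q =
      ∫ y, ∫ z, f z ∂Kernel.partialTraj (stepKernel K) p q y ∂pathLaw K x₀ p := by
  rw [pathLaw, pathLaw, ← Kernel.partialTraj_comp_partialTraj (Nat.zero_le p) hpq,
    Kernel.integral_comp (hf.integrable _)]

lemma integral_pathLaw_succ (p : ℕ) {f : Path E (p + 1) → ℝ} (hf : IsBddMeas f) :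
    ∫ y, f y ∂pathLaw K x₀ (p + 1) = ∫ y, ∫ z, f z ∂histKernel K p y ∂pathLaw K x₀ p :=
  integral_pathLaw_partialTraj K x₀ p.le_succ hf

/-- A `partialTraj` transition keeps the past. -/
lemma ae_partialTraj {p q : ℕ} (hpq : p ≤ q) {u : Path E p → ℝ} (hu : Measurable u)
    (y : Path E p) :
    ∀ᵐ z ∂Kernel.partialTraj (stepKernel K) p q y, u (frestrictLe₂ hpq z) = u y := by
  have h : (Kernel.partialTraj (stepKernel K) p q y).map (frestrictLe₂ hpq) = Measure.dirac y := by
    rw [Kernel.partialTraj_map_frestrictLe₂_apply, Kernel.partialTraj_self, Kernel.id_apply]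
  refine ae_of_ae_map (p := fun w => u w = u y)
    (measurable_frestrictLe₂ (X := E) hpq).aemeasurable ?_
  rw [h]
  exact (ae_dirac_iff (hu (measurableSet_singleton (u y)))).2 rfl

/-- Factors depending on the past are almost surely constant under the transition, hence come out of
the integral. No integrability of f is needed, since constants always factor out of a Bochner
integral. -/
lemma integral_partialTraj_mul {p q : ℕ} (hpq : p ≤ q) {u : Path E p → ℝ} (hu : Measurable u)
    (f : Path E q → ℝ) (y : Path E p) :
    ∫ z, u (frestrictLe₂ hpq z) * f z ∂Kernel.partialTraj (stepKernel K) p q y =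
      u y * ∫ z, f z ∂Kernel.partialTraj (stepKernel K) p q y := by
  rw [← integral_const_mul]
  refine integral_congr_ae ?_
  filter_upwards [ae_partialTraj K hpq hu y] with z hz
  rw [hz]

lemma integral_histKernel_mul {p : ℕ} {u : Path E p → ℝ} (hu : Measurable u)
    (f : Path E (p + 1) → ℝ) (y : Path E p) :
    ∫ z, u (frestrictLe₂ p.le_succ z) * f z ∂histKernel K p y =
      u y * ∫ z, f z ∂histKernel K p y :=
  integral_partialTraj_mul K p.le_succ hu f y

lemma integral_histKernel_endpoint {p : ℕ} {f : E (p + 1) → ℝ} (hf : Measurable f)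
    (y : Path E p) :
    ∫ z, f (endpoint z) ∂histKernel K p y = ∫ x, f x ∂K p (endpoint y) := by
  have h := Kernel.map_partialTraj_succ_self (κ := stepKernel K) p
  have h' : (histKernel K p y).map endpoint = K p (endpoint y) := by
    rw [histKernel, ← Kernel.map_apply _ (measurable_endpoint _)]
    change (Kernel.map _ (fun x : Path E (p + 1) => x ⟨p + 1, Finset.mem_Iic.2 le_rfl⟩)) y = _
    rw [h, stepKernel, Kernel.comap_apply]
  rw [← h', integral_map (measurable_endpoint _).aemeasurable hf.aestronglyMeasurable]

variable (G : (k : ℕ) → Path E k → ℝ)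

/-- The unnormalized transition `Q_{p+1}(f)(y) = G_p(y) M_{p+1}(f)(y)`. -/
noncomputable def fkStep (p : ℕ) (f : Path E (p + 1) → ℝ) (y : Path E p) : ℝ :=
  G p y * ∫ z, f z ∂histKernel K p y

variable {G}

lemma isBddMeas_fkStep {p : ℕ} (hG : IsRegularPotential (G p)) {f : Path E (p + 1) → ℝ}
    (hf : IsBddMeas f) : IsBddMeas (fkStep K G p f) :=
  hG.isBddMeas.mul (hf.integral_kernel _)

lemma gammaFlow_eq {p : ℕ} (hG : ∀ k, 1 ≤ k → k < p → IsRegularPotential (G k))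
    {f : Path E p → ℝ} (hf : Measurable f) :
    gammaFlow K x₀ G p f = ∫ y, f y * pathWeight G p y ∂pathLaw K x₀ p :=
  integral_chainLaw K x₀ (hf.mul (isBddMeas_pathWeight hG).measurable)

lemma gammaFlow_one {f : Path E 1 → ℝ} (hf : Measurable f) :
    gammaFlow K x₀ G 1 f = ∫ y, f y ∂histKernel K 0 (initPath x₀) := by
  rw [gammaFlow_eq K x₀ (fun k h1 h2 => absurd h1 h2.not_ge) hf]
  simp only [pathWeight_one, mul_one]
  rfl

/-- The weight at time p + 1 involves only the path up to time p, so it comes out of the last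
transition; its last factor G_p combines with that transition into Q. This drives every induction on
time. -/
lemma gammaFlow_succ {p : ℕ} (hp : 1 ≤ p)
    (hG : ∀ k, 1 ≤ k → k < p + 1 → IsRegularPotential (G k))
    {f : Path E (p + 1) → ℝ} (hf : IsBddMeas f) :
    gammaFlow K x₀ G (p + 1) f = gammaFlow K x₀ G p (fkStep K G p f) := by
  have hG' : ∀ k, 1 ≤ k → k < p → IsRegularPotential (G k) :=
    fun k h1 h2 => hG k h1 (h2.trans p.lt_succ_self)
  have hGp := hG p hp p.lt_succ_self
  rw [gammaFlow_eq K x₀ hG hf.measurable,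
    gammaFlow_eq K x₀ hG' (isBddMeas_fkStep K hGp hf).measurable,
    integral_pathLaw_succ K x₀ p (hf.mul (isBddMeas_pathWeight hG))]
  refine integral_congr_ae (ae_of_all _ fun y => ?_)
  have := integral_histKernel_mul K
    ((isBddMeas_pathWeight hG').measurable.mul hGp.measurable) f y
  simp only [Pi.mul_apply] at this
  simp only [pathWeight_succ G hp, fkStep]
  rw [mul_right_comm, mul_comm (G p y), ← this]
  exact integral_congr_ae (ae_of_all _ fun z => mul_comm _ _)

lemma gammaFlow_one_pos {p : ℕ} (hG : ∀ k, 1 ≤ k → k < p → IsRegularPotential (G k)) :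
    0 < gammaFlow K x₀ G p (fun _ => 1) := by
  rw [gammaFlow_eq K x₀ hG measurable_const]
  have hb := isBddMeas_pathWeight hG
  have hpos := pathWeight_pos (G := G) (p := p) fun k h1 h2 => (hG k h1 h2).pos
  simp only [one_mul]
  rw [integral_pos_iff_support_of_nonneg (fun y => (hpos y).le) (hb.integrable _)]
  have : Function.support (pathWeight G p) = Set.univ :=
    Set.eq_univ_of_forall fun y => (hpos y).ne'
  simp [this]

end Chain
-- Quantitative central limit theorem for bounded independent variables.
section PowerBounds

/-- Telescoping in the closed unit disc. It reduces the comparison of N-fold products of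
characteristic functions to that of a single factor. -/
lemma norm_pow_sub_pow_le {z w : ℂ} (hz : ‖z‖ ≤ 1) (hw : ‖w‖ ≤ 1) (N : ℕ) :
    ‖z ^ N - w ^ N‖ ≤ N * ‖z - w‖ := by
  induction N with
  | zero => simp
  | succ N ih =>
    have h : z ^ (N + 1) - w ^ (N + 1) = (z ^ N - w ^ N) * z + w ^ N * (z - w) := by ring
    rw [h]
    calc ‖(z ^ N - w ^ N) * z + w ^ N * (z - w)‖
        ≤ ‖z ^ N - w ^ N‖ * ‖z‖ + ‖w‖ ^ N * ‖z - w‖ := by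
          refine (norm_add_le _ _).trans ?_
          rw [norm_mul, norm_mul, norm_pow]
      _ ≤ N * ‖z - w‖ * 1 + 1 * ‖z - w‖ := by
          gcongr
          exact pow_le_one₀ (norm_nonneg _) hw
      _ = (N + 1 : ℕ) * ‖z - w‖ := by push_cast; ring

lemma norm_cexp_sub_quadratic_le (x : ℂ) :
    ‖Complex.exp x - (1 + x + x ^ 2 / 2)‖ ≤ ‖x‖ ^ 3 * Real.exp ‖x‖ := by
  simpa [Finset.sum_range_succ] using Complex.norm_exp_sub_sum_le_norm_mul_exp x 3

lemma norm_cexp_sub_linear_le (x : ℂ) :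
    ‖Complex.exp x - (1 + x)‖ ≤ ‖x‖ ^ 2 * Real.exp ‖x‖ := by
  simpa [Finset.sum_range_succ] using Complex.norm_exp_sub_sum_le_norm_mul_exp x 2

end PowerBounds

lemma abs_empMean_le {F : Type*} {N : ℕ} {f : F → ℝ} {C : ℝ} (hC0 : 0 ≤ C) (hC : ∀ y, |f y| ≤ C)
    (y : Fin N → F) : |empMean y f| ≤ C := by
  rw [empMean, abs_mul, abs_of_nonneg (by positivity : (0:ℝ) ≤ (N : ℝ)⁻¹)]
  calc (N : ℝ)⁻¹ * |∑ i, f (y i)| ≤ (N : ℝ)⁻¹ * ∑ _i : Fin N, C := by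
        gcongr
        exact (Finset.abs_sum_le_sum_abs _ _).trans (Finset.sum_le_sum fun i _ => hC _)
    _ = ((N : ℝ)⁻¹ * N) * C := by simp [mul_assoc]
    _ ≤ 1 * C := by gcongr; exact inv_mul_le_one
    _ = C := one_mul C

section IID

variable {F : Type*} [MeasurableSpace F] (ν : Measure F) [IsProbabilityMeasure ν]

lemma isBddMeas_empMean {N : ℕ} {f : F → ℝ} (hf : IsBddMeas f) :
    IsBddMeas (fun y : Fin N → F => empMean y f) := by
  obtain ⟨C, hC0, hC⟩ := hf.exists_bound
  refine ⟨?_, (N : ℝ)⁻¹ * ∑ _i : Fin N, C, fun y => ?_⟩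
  · unfold empMean
    exact measurable_const.mul (Finset.measurable_sum _ fun i _ =>
      hf.measurable.comp (measurable_pi_apply i))
  · rw [empMean, abs_mul, abs_of_nonneg (by positivity : (0:ℝ) ≤ (N : ℝ)⁻¹)]
    gcongr
    exact (Finset.abs_sum_le_sum_abs _ _).trans (Finset.sum_le_sum fun i _ => hC _)

lemma integral_pi_eval {N : ℕ} {f : F → ℝ} (hf : Measurable f) (i : Fin N) :
    ∫ y, f (y i) ∂Measure.pi (fun _ : Fin N => ν) = ∫ x, f x ∂ν := by
  have h := (measurePreserving_eval (fun _ : Fin N => ν) i).map_eq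
  conv_rhs => rw [← h]
  rw [integral_map (measurable_pi_apply i).aemeasurable hf.aestronglyMeasurable]

lemma integral_empMean {N : ℕ} (hN : 1 ≤ N) {f : F → ℝ} (hf : IsBddMeas f) :
    ∫ y, empMean y f ∂Measure.pi (fun _ : Fin N => ν) = ∫ x, f x ∂ν := by
  unfold empMean
  rw [integral_const_mul, integral_finsetSum _ fun i _ =>
    (hf.comp (measurable_pi_apply i)).integrable _]
  simp_rw [integral_pi_eval ν hf.measurable]
  have : (N : ℝ) ≠ 0 := by positivity
  simp [this]

/-- Independence of centered variables: this kills the off-diagonal terms of the variance of an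
empirical mean. -/
lemma integral_pi_mul_eval {N : ℕ} {f : F → ℝ} (h0 : ∫ x, f x ∂ν = 0)
    {i j : Fin N} (hij : i ≠ j) :
    ∫ y, f (y i) * f (y j) ∂Measure.pi (fun _ : Fin N => ν) = 0 := by
  have h := integral_fintype_prod_eq_prod (μ := fun _ : Fin N => ν)
    (fun k x => if k = i then f x else if k = j then f x else 1)
  have h1 : ∀ y : Fin N → F,
      (∏ k, if k = i then f (y k) else if k = j then f (y k) else 1) = f (y i) * f (y j) := by
    intro y
    rw [← Finset.mul_prod_erase _ _ (Finset.mem_univ i),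
      ← Finset.mul_prod_erase (Finset.univ.erase i) _
        (Finset.mem_erase.2 ⟨hij.symm, Finset.mem_univ j⟩),
      Finset.prod_eq_one]
    · simp [hij.symm]
    · intro k hk
      simp only [Finset.mem_erase, Finset.mem_univ, and_true] at hk
      simp [hk.1, hk.2]
  simp_rw [h1] at h
  rw [h]
  exact Finset.prod_eq_zero (Finset.mem_univ i) (by simpa using h0)

/-- The mean square error of an empirical mean of `N` independent variables. -/
lemma integral_sq_empMean_sub_le {N : ℕ} (hN : 1 ≤ N) {f : F → ℝ} (hf : Measurable f) {B : ℝ}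
    (hB0 : 0 ≤ B) (hB : ∀ y, |f y| ≤ B) :
    ∫ y, (empMean y f - ∫ x, f x ∂ν) ^ 2 ∂Measure.pi (fun _ : Fin N => ν) ≤ (2 * B) ^ 2 / N := by
  have hfb : IsBddMeas f := ⟨hf, B, hB⟩
  set m := ∫ x, f x ∂ν with hm
  have hmB : |m| ≤ B := IsBddMeas.abs_integral_le hB ν
  set g : F → ℝ := fun x => f x - m with hg
  have hgb : IsBddMeas g := hfb.sub (IsBddMeas.const m)
  have hgB : ∀ x, |g x| ≤ 2 * B := fun x =>
    (abs_sub _ _).trans (by linarith [hB x])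
  have hg0 : ∫ x, g x ∂ν = 0 := by
    rw [hg, integral_sub (hfb.integrable _) (integrable_const _)]
    simp [hm]
  have hNpos : (0 : ℝ) < N := by exact_mod_cast hN
  have h1 : ∀ y : Fin N → F,
      (empMean y f - m) ^ 2 = ((N : ℝ)⁻¹) ^ 2 * ∑ i, ∑ j, g (y i) * g (y j) := by
    intro y
    rw [← Finset.sum_mul_sum, ← sq, ← mul_pow]
    congr 1
    rw [hg, Finset.sum_sub_distrib, mul_sub, empMean]
    simp [hNpos.ne']
  have hint : ∀ i j : Fin N, Integrable (fun y : Fin N → F => g (y i) * g (y j))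
      (Measure.pi (fun _ : Fin N => ν)) := fun i j =>
    ((hgb.comp (measurable_pi_apply i)).mul (hgb.comp (measurable_pi_apply j))).integrable _
  simp_rw [h1]
  rw [integral_const_mul, integral_finsetSum _ fun i _ => integrable_finsetSum _ fun j _ =>
    hint i j]
  have h2 : ∀ i : Fin N, ∫ y, ∑ j, g (y i) * g (y j) ∂Measure.pi (fun _ : Fin N => ν) ≤
      (2 * B) ^ 2 := by
    intro i
    rw [integral_finsetSum _ fun j _ => hint i j, Finset.sum_eq_single i]
    · refine (le_abs_self _).trans (IsBddMeas.abs_integral_le (fun y => ?_) _)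
      rw [abs_mul, sq]
      exact mul_le_mul (hgB _) (hgB _) (abs_nonneg _) (by positivity)
    · exact fun j _ hj => integral_pi_mul_eval ν hg0 hj.symm
    · simp
  calc ((N : ℝ)⁻¹) ^ 2 * ∑ i, ∫ y, ∑ j, g (y i) * g (y j) ∂Measure.pi (fun _ : Fin N => ν)
      ≤ ((N : ℝ)⁻¹) ^ 2 * ∑ _i : Fin N, (2 * B) ^ 2 := by
        gcongr with i
        exact h2 i
    _ = (2 * B) ^ 2 / N := by
        simp
        field_simp

/-- Second order expansion of the characteristic function of a centered bounded variable. -/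
lemma norm_integral_cexp_sub_le {g : F → ℝ} (hg : Measurable g) {B : ℝ} (hB0 : 0 ≤ B)
    (hB : ∀ x, |g x| ≤ B) (h0 : ∫ x, g x ∂ν = 0) (s : ℝ) :
    ‖∫ x, Complex.exp ((s * g x : ℝ) * Complex.I) ∂ν -
        Complex.exp (-(s ^ 2 * (∫ x, g x ^ 2 ∂ν) / 2 : ℝ))‖ ≤
      (|s| * B) ^ 3 * Real.exp (|s| * B) + ((|s| * B) ^ 2) ^ 2 * Real.exp ((|s| * B) ^ 2) := by
  have hgb : IsBddMeas g := ⟨hg, B, hB⟩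
  set v := ∫ x, g x ^ 2 ∂ν with hv
  have hv0 : 0 ≤ v := integral_nonneg fun x => sq_nonneg _
  have hvB : v ≤ B ^ 2 := by
    refine (le_abs_self _).trans (IsBddMeas.abs_integral_le (fun x => ?_) _)
    rw [abs_pow]
    exact pow_le_pow_left₀ (abs_nonneg _) (hB x) 2
  -- The second-order Taylor polynomial integrates to 1 - s²v/2 because the linear term vanishes by
  -- centering; it serves as the midpoint between the characteristic function and the Gaussian.
  have hquad : ∫ x, (1 + ((s * g x : ℝ) * Complex.I : ℂ) +
      ((s * g x : ℝ) * Complex.I : ℂ) ^ 2 / 2) ∂ν = 1 + (-(s ^ 2 * v / 2 : ℝ) : ℂ) := by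
    have e1 : ∀ x, (1 + ((s * g x : ℝ) * Complex.I : ℂ) +
        ((s * g x : ℝ) * Complex.I : ℂ) ^ 2 / 2) =
        ((1 - s ^ 2 / 2 * g x ^ 2 : ℝ) : ℂ) + ((s * g x : ℝ) : ℂ) * Complex.I := by
      intro x
      rw [mul_pow, Complex.I_sq]
      push_cast
      ring
    simp_rw [e1]
    have i1 : Integrable (fun x => 1 - s ^ 2 / 2 * g x ^ 2) ν :=
      ((IsBddMeas.const 1).sub ((IsBddMeas.const _).mul (hgb.pow 2))).integrable _
    have i2 : Integrable (fun x => s * g x) ν := ((IsBddMeas.const s).mul hgb).integrable _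
    rw [integral_add i1.ofReal (i2.ofReal.mul_const _), integral_mul_const,
      integral_complex_ofReal, integral_complex_ofReal, integral_const_mul, h0,
      integral_sub (integrable_const _) (((hgb.pow 2).integrable _).const_mul _),
      integral_const_mul]
    simp
    ring
  have hexp : ‖∫ x, Complex.exp ((s * g x : ℝ) * Complex.I) ∂ν -
      (1 + (-(s ^ 2 * v / 2 : ℝ) : ℂ))‖ ≤ (|s| * B) ^ 3 * Real.exp (|s| * B) := by
    rw [← hquad, ← integral_sub]
    · refine (norm_integral_le_of_norm_le_const (C := (|s| * B) ^ 3 * Real.exp (|s| * B))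
        (ae_of_all _ fun x => ?_)).trans (by simp)
      refine (norm_cexp_sub_quadratic_le _).trans ?_
      have : ‖((s * g x : ℝ) * Complex.I : ℂ)‖ ≤ |s| * B := by
        rw [norm_mul, Complex.norm_I, mul_one, Complex.norm_real, Real.norm_eq_abs, abs_mul]
        exact mul_le_mul_of_nonneg_left (hB x) (abs_nonneg _)
      gcongr
    · refine Integrable.of_bound (Measurable.aestronglyMeasurable (by fun_prop)) 1
        (ae_of_all _ fun x => ?_)
      rw [Complex.norm_exp_ofReal_mul_I]
    · have i2 : Integrable (fun x => ((s * g x : ℝ) : ℂ) * Complex.I) ν :=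
        (((IsBddMeas.const s).mul hgb).integrable ν).ofReal.mul_const _
      refine ((integrable_const _).add i2).add ?_
      have e : ∀ x, ((s * g x : ℝ) * Complex.I : ℂ) ^ 2 / 2 =
          ((-(s ^ 2 / 2) * g x ^ 2 : ℝ) : ℂ) := by
        intro x
        rw [mul_pow, Complex.I_sq]
        push_cast
        ring
      simp_rw [e]
      exact (((IsBddMeas.const _).mul (hgb.pow 2)).integrable ν).ofReal
  have hgauss : ‖Complex.exp (-(s ^ 2 * v / 2 : ℝ) : ℂ) - (1 + (-(s ^ 2 * v / 2 : ℝ) : ℂ))‖ ≤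
      ((|s| * B) ^ 2) ^ 2 * Real.exp ((|s| * B) ^ 2) := by
    refine (norm_cexp_sub_linear_le _).trans ?_
    have : ‖(-(s ^ 2 * v / 2 : ℝ) : ℂ)‖ ≤ (|s| * B) ^ 2 := by
      rw [norm_neg, Complex.norm_real, Real.norm_eq_abs, abs_of_nonneg (by positivity), mul_pow,
        sq_abs]
      have := mul_le_mul_of_nonneg_left hvB (sq_nonneg s)
      nlinarith [mul_nonneg (sq_nonneg s) hv0]
    gcongr
  calc _ ≤ _ := norm_sub_le_norm_sub_add_norm_sub _ (1 + (-(s ^ 2 * v / 2 : ℝ) : ℂ)) _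
    _ ≤ _ := add_le_add hexp (by rw [norm_sub_rev]; exact hgauss)

/-- The constant of the quantitative central limit theorem `norm_integral_cexp_empMean_sub_le`. -/
noncomputable def charConst (R : ℝ) : ℝ :=
  R ^ 3 * Real.exp R + (R ^ 2) ^ 2 * Real.exp (R ^ 2)

/-- Quantitative central limit theorem for bounded independent variables, at the level of
characteristic functions and uniform in the law of the variables. -/
lemma norm_integral_cexp_empMean_sub_le {N : ℕ} (hN : 1 ≤ N) {f : F → ℝ} (hf : Measurable f)
    {B : ℝ} (hB0 : 0 ≤ B) (hB : ∀ y, |f y| ≤ B) {r R : ℝ} (hr : |r| * (2 * B) ≤ R) :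
    ‖∫ y, Complex.exp ((r * (√N * (empMean y f - ∫ x, f x ∂ν)) : ℝ) * Complex.I)
          ∂Measure.pi (fun _ : Fin N => ν) -
        Complex.exp (-(r ^ 2 * (∫ x, f x ^ 2 ∂ν - (∫ x, f x ∂ν) ^ 2) / 2 : ℝ))‖ ≤
      charConst R / √N := by
  have hfb : IsBddMeas f := ⟨hf, B, hB⟩
  set m := ∫ x, f x ∂ν with hm
  have hmB : |m| ≤ B := IsBddMeas.abs_integral_le hB ν
  set g : F → ℝ := fun x => f x - m with hg
  have hgb : IsBddMeas g := hfb.sub (IsBddMeas.const m)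
  have hgB : ∀ x, |g x| ≤ 2 * B := fun x => (abs_sub _ _).trans (by linarith [hB x])
  have hg0 : ∫ x, g x ∂ν = 0 := by
    rw [hg, integral_sub (hfb.integrable _) (integrable_const _)]
    simp [hm]
  have hg2 : ∫ x, g x ^ 2 ∂ν = ∫ x, f x ^ 2 ∂ν - m ^ 2 := by
    have e : ∀ x, g x ^ 2 = f x ^ 2 - (2 * m * f x - m ^ 2) := fun x => by simp only [hg]; ring
    simp_rw [e]
    have i1 : Integrable (fun x => 2 * m * f x - m ^ 2) ν :=
      (((IsBddMeas.const _).mul hfb).sub (IsBddMeas.const _)).integrable _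
    rw [integral_sub ((hfb.pow 2).integrable _) i1,
      integral_sub ((hfb.integrable _).const_mul _) (integrable_const _), integral_const_mul, ← hm]
    simp
    ring
  have hN1 : (1 : ℝ) ≤ N := by exact_mod_cast hN
  have hNpos : (0 : ℝ) < N := by linarith
  have hsq : √(N : ℝ) * √N = N := Real.mul_self_sqrt hNpos.le
  have hsq1 : 1 ≤ √(N : ℝ) := Real.one_le_sqrt.2 hN1
  have hsqpos : 0 < √(N : ℝ) := by linarith
  -- With this scaling the exponent is a sum of N terms s g(y_i), so the integral is an N-th power.
  set s : ℝ := r / √N with hs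
  have hsum : ∀ y : Fin N → F, Complex.exp ((r * (√N * (empMean y f - m)) : ℝ) * Complex.I) =
      ∏ i, Complex.exp ((s * g (y i) : ℝ) * Complex.I) := by
    intro y
    rw [← Complex.exp_sum, ← Finset.sum_mul, ← Complex.ofReal_sum, ← Finset.mul_sum]
    congr 3
    have e : ∑ i, g (y i) = N * (empMean y f - m) := by
      rw [hg, Finset.sum_sub_distrib, empMean]
      simp
      field_simp
    rw [e, hs]
    field_simp
    rw [sq, hsq]
    ring
  have hpow : Complex.exp (-(r ^ 2 * (∫ x, f x ^ 2 ∂ν - m ^ 2) / 2 : ℝ)) =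
      Complex.exp (-(s ^ 2 * (∫ x, g x ^ 2 ∂ν) / 2 : ℝ)) ^ N := by
    rw [← Complex.exp_nat_mul, hg2]
    congr 1
    have : r ^ 2 = N * s ^ 2 := by
      rw [hs, div_pow, sq √(N : ℝ), hsq]
      field_simp
    rw [this]
    push_cast
    ring
  simp_rw [hsum]
  rw [integral_fintype_prod_eq_pow (fun x => Complex.exp ((s * g x : ℝ) * Complex.I)),
    Fintype.card_fin, hpow]
  have hg2nn : 0 ≤ ∫ x, g x ^ 2 ∂ν := integral_nonneg fun x => sq_nonneg _
  refine (norm_pow_sub_pow_le ?_ ?_ N).trans ?_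
  · refine (norm_integral_le_of_norm_le_const (C := 1) (ae_of_all _ fun x => ?_)).trans (by simp)
    rw [Complex.norm_exp_ofReal_mul_I]
  · rw [← Complex.ofReal_neg, ← Complex.ofReal_exp, Complex.norm_real, Real.norm_eq_abs,
      Real.abs_exp]
    exact Real.exp_le_one_iff.2 (by simp only [Left.neg_nonpos_iff]; positivity)
  · refine (mul_le_mul_of_nonneg_left
      (norm_integral_cexp_sub_le ν hgb.measurable (by positivity) hgB hg0 s) hNpos.le).trans ?_
    have hR0 : 0 ≤ R := le_trans (by positivity) hr
    have hsR : |s| * (2 * B) ≤ R / √N := by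
      rw [hs, abs_div, abs_of_pos hsqpos, div_mul_eq_mul_div]
      gcongr
    have hRN : R / √N ≤ R := div_le_self hR0 hsq1
    have hsB : 0 ≤ |s| * (2 * B) := by positivity
    -- Since |s| 2B ≤ R/√N, the cubic remainder times N is of order 1/√N. The quartic one is of
    -- order 1/N, which is weakened to 1/√N.
    calc (N : ℝ) * ((|s| * (2 * B)) ^ 3 * Real.exp (|s| * (2 * B)) +
            ((|s| * (2 * B)) ^ 2) ^ 2 * Real.exp ((|s| * (2 * B)) ^ 2))
        ≤ N * ((R / √N) ^ 3 * Real.exp R + ((R / √N) ^ 2) ^ 2 * Real.exp (R ^ 2)) := by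
          have := hsR.trans hRN
          gcongr
      _ = R ^ 3 * Real.exp R / √N + (R ^ 2) ^ 2 * Real.exp (R ^ 2) / √N / √N := by
          have e : (N : ℝ) = √N ^ 2 := by rw [sq, hsq]
          have e' : ∀ a b q : ℝ, q ≠ 0 → q ^ 2 * ((R / q) ^ 3 * a + ((R / q) ^ 2) ^ 2 * b) =
            R ^ 3 * a / q + (R ^ 2) ^ 2 * b / q / q := by
            intro a b q hq
            field_simp
          rw [← e' _ _ _ hsqpos.ne', ← e]
      _ ≤ R ^ 3 * Real.exp R / √N + (R ^ 2) ^ 2 * Real.exp (R ^ 2) / √N := by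
          gcongr
          exact div_le_self (by positivity) hsq1
      _ = charConst R / √N := by rw [charConst, add_div]

end IID
-- Conditionally independent samples.
section CondIID

variable {Ω S F : Type*} [MeasurableSpace Ω] [MeasurableSpace S] [MeasurableSpace F]

/-- The kernel `z ↦ ν(z, ·)^{⊗ N}`. -/
noncomputable def piKernel (N : ℕ) (ν : Kernel S F) [IsMarkovKernel ν] :
    Kernel S (Fin N → F) where
  toFun z := Measure.pi fun _ => ν z
  measurable' := by
    -- Measurability is tested on the π-system of boxes, whose mass is a product of N measurable
    -- functions of z.
    refine Measurable.measure_of_isPiSystem_of_isProbabilityMeasure generateFrom_pi.symm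
      isPiSystem_pi ?_
    rintro _ ⟨s, hs, rfl⟩
    simp only [Set.mem_pi, Set.mem_univ, forall_const, Set.mem_ofPred_eq] at hs
    simp_rw [Measure.pi_pi]
    exact Finset.measurable_prod _ fun i _ => ν.measurable_coe (hs i)

lemma piKernel_apply (N : ℕ) (ν : Kernel S F) [IsMarkovKernel ν] (z : S) :
    piKernel N ν z = Measure.pi fun _ => ν z := rfl

instance (N : ℕ) (ν : Kernel S F) [IsMarkovKernel ν] : IsMarkovKernel (piKernel N ν) :=
  ⟨fun z => by rw [piKernel_apply]; infer_instance⟩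

/-- Conditionally on `Z`, the `N` components of `X` are independent with common law `ν Z`. -/
structure IsCondIID {N : ℕ} (μ : Measure Ω) (Z : Ω → S) (X : Ω → Fin N → F) (ν : Kernel S F) :
    Prop where
  measurable_left : Measurable Z
  measurable_right : Measurable X
  lintegral_eq : ∀ f : S × (Fin N → F) → ℝ≥0∞, Measurable f →
    ∫⁻ ω, f (Z ω, X ω) ∂μ = ∫⁻ ω, ∫⁻ y, f (Z ω, y) ∂Measure.pi (fun _ => ν (Z ω)) ∂μ

namespace IsCondIID

variable {N : ℕ} {μ : Measure Ω} {Z : Ω → S} {X : Ω → Fin N → F}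
  {ν : Kernel S F} [IsMarkovKernel ν]

lemma isBddMeas_error {c : S → ℝ} (hc : IsBddMeas c) {f : F → ℝ} (hf : IsBddMeas f) :
    IsBddMeas (fun q : S × (Fin N → F) => c q.1 * (empMean q.2 f - ∫ x, f x ∂ν q.1)) :=
  (hc.comp measurable_fst).mul (((isBddMeas_empMean hf).comp measurable_snd).sub
    ((hf.integral_kernel ν).comp measurable_fst))

lemma isBddMeas_error_comp (h : IsCondIID μ Z X ν) {c : S → ℝ} (hc : IsBddMeas c) {f : F → ℝ}
    (hf : IsBddMeas f) :
    IsBddMeas (fun ω => c (Z ω) * (empMean (X ω) f - ∫ x, f x ∂ν (Z ω))) :=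
  (isBddMeas_error hc hf).comp (h.measurable_left.prodMk h.measurable_right)

variable [IsProbabilityMeasure μ]

/-- The identity for nonnegative functions determines the joint law as a composition-product; Fubini
for real and complex integrands follows from this form. -/
lemma map_eq (h : IsCondIID μ Z X ν) :
    μ.map (fun ω => (Z ω, X ω)) = μ.map Z ⊗ₘ piKernel N ν := by
  refine Measure.ext_of_lintegral _ fun f hf => ?_
  rw [lintegral_map hf (h.measurable_left.prodMk h.measurable_right), h.lintegral_eq f hf,
    Measure.lintegral_compProd hf, lintegral_map _ h.measurable_left]
  · rfl
  · exact hf.lintegral_kernel_prod_right'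

lemma integral_eq {𝕜 : Type*} [RCLike 𝕜] (h : IsCondIID μ Z X ν)
    {f : S × (Fin N → F) → 𝕜} (hf : Measurable f) {C : ℝ} (hC : ∀ x, ‖f x‖ ≤ C) :
    ∫ ω, f (Z ω, X ω) ∂μ = ∫ ω, ∫ y, f (Z ω, y) ∂Measure.pi (fun _ => ν (Z ω)) ∂μ := by
  have hZ := Measure.isProbabilityMeasure_map (μ := μ) h.measurable_left.aemeasurable
  rw [← integral_map (φ := fun ω => (Z ω, X ω))
    (h.measurable_left.prodMk h.measurable_right).aemeasurable hf.aestronglyMeasurable, h.map_eq,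
    Measure.integral_compProd (Integrable.of_bound hf.aestronglyMeasurable C (ae_of_all _ hC)),
    integral_map h.measurable_left.aemeasurable]
  · rfl
  · exact (hf.stronglyMeasurable.integral_kernel_prod_right'
      (κ := piKernel N ν)).aestronglyMeasurable

lemma integral_mul_empMean (h : IsCondIID μ Z X ν) (hN : 1 ≤ N) {c : S → ℝ} (hc : IsBddMeas c)
    {f : F → ℝ} (hf : IsBddMeas f) :
    ∫ ω, c (Z ω) * empMean (X ω) f ∂μ = ∫ ω, c (Z ω) * ∫ x, f x ∂ν (Z ω) ∂μ := by
  have hb : IsBddMeas (fun q : S × (Fin N → F) => c q.1 * empMean q.2 f) :=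
    (hc.comp measurable_fst).mul ((isBddMeas_empMean hf).comp measurable_snd)
  obtain ⟨C, hC⟩ := hb.bounded
  rw [h.integral_eq hb.measurable hC]
  refine integral_congr_ae (ae_of_all _ fun ω => ?_)
  simp only
  rw [integral_const_mul, integral_empMean _ hN hf]

lemma integral_sq_error_le (h : IsCondIID μ Z X ν) (hN : 1 ≤ N) {c : S → ℝ} (hc : Measurable c)
    {C : ℝ} (hC : ∀ z, |c z| ≤ C) {f : F → ℝ} (hf : Measurable f) {B : ℝ} (hB0 : 0 ≤ B)
    (hB : ∀ x, |f x| ≤ B) :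
    ∫ ω, (c (Z ω) * (empMean (X ω) f - ∫ x, f x ∂ν (Z ω))) ^ 2 ∂μ ≤ C ^ 2 * (2 * B) ^ 2 / N := by
  have hb := (isBddMeas_error (N := N) (ν := ν) ⟨hc, C, hC⟩ ⟨hf, B, hB⟩).pow 2
  obtain ⟨D, hD⟩ := hb.bounded
  rw [h.integral_eq hb.measurable hD]
  refine (integral_mono_of_nonneg (g := fun _ => C ^ 2 * (2 * B) ^ 2 / N)
    (ae_of_all _ fun ω => integral_nonneg fun y => sq_nonneg _) (integrable_const _)
    (ae_of_all _ fun ω => ?_)).trans (by simp)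
  simp only [mul_pow]
  rw [integral_const_mul, mul_div_assoc, ← mul_pow]
  refine mul_le_mul ?_ (integral_sq_empMean_sub_le _ hN hf hB0 hB)
    (integral_nonneg fun y => sq_nonneg _) (sq_nonneg _)
  rw [← sq_abs]
  exact pow_le_pow_left₀ (abs_nonneg _) (hC _) 2

/-- Conditional central limit theorem, at the level of characteristic functions. -/
lemma norm_integral_cexp_sub_le (h : IsCondIID μ Z X ν) (hN : 1 ≤ N) {c : S → ℝ}
    (hc : Measurable c) {C : ℝ} (hC : ∀ z, |c z| ≤ C) {f : F → ℝ} (hf : Measurable f) {B : ℝ}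
    (hB0 : 0 ≤ B) (hB : ∀ x, |f x| ≤ B) {A : S → ℝ} (hA : Measurable A) (t : ℝ) :
    ‖∫ ω, Complex.exp ((t * (A (Z ω) +
          √N * (c (Z ω) * (empMean (X ω) f - ∫ x, f x ∂ν (Z ω)))) : ℝ) * Complex.I) ∂μ -
        ∫ ω, Complex.exp ((t * A (Z ω) : ℝ) * Complex.I) *
          Complex.exp (-(t ^ 2 * (c (Z ω) ^ 2 *
            (∫ x, f x ^ 2 ∂ν (Z ω) - (∫ x, f x ∂ν (Z ω)) ^ 2)) / 2 : ℝ)) ∂μ‖ ≤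
      charConst (|t| * C * (2 * B)) / √N := by
  have hfb : IsBddMeas f := ⟨hf, B, hB⟩
  have he := isBddMeas_error (N := N) (ν := ν) ⟨hc, C, hC⟩ hfb
  have hν := (hfb.integral_kernel ν).measurable
  have hν2 := ((hfb.pow 2).integral_kernel ν).measurable
  have hm : Measurable fun q : S × (Fin N → F) => Complex.exp ((t * (A q.1 +
      √N * (c q.1 * (empMean q.2 f - ∫ x, f x ∂ν q.1))) : ℝ) * Complex.I) := by
    have h1 : Measurable fun q : S × (Fin N → F) => t * (A q.1 +
      √N * (c q.1 * (empMean q.2 f - ∫ x, f x ∂ν q.1))) :=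
      ((hA.comp measurable_fst).add (he.measurable.const_mul _)).const_mul _
    fun_prop
  -- This is a variance; its sign keeps the Gaussian factor bounded by 1 and hence integrable.
  have hvar : ∀ z, 0 ≤ ∫ x, f x ^ 2 ∂ν z - (∫ x, f x ∂ν z) ^ 2 := by
    intro z
    have hvz := variance_eq_sub (μ := ν z) (X := f) (MemLp.of_bound hf.aestronglyMeasurable B
      (ae_of_all _ hB))
    have := variance_nonneg f (ν z)
    rw [hvz] at this
    simpa using this
  rw [h.integral_eq hm (C := 1) (fun q => by rw [Complex.norm_exp_ofReal_mul_I]), ← integral_sub]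
  · refine (norm_integral_le_of_norm_le_const (C := charConst (|t| * C * (2 * B)) / √N)
      (ae_of_all _ fun ω => ?_)).trans (by simp)
    -- The contribution of A(Z) has modulus one and is constant given Z, so only the independent
    -- sample has to be treated, with frequency t c(Z).
    have hsplit : ∀ y : Fin N → F, Complex.exp ((t * (A (Z ω) +
        √N * (c (Z ω) * (empMean y f - ∫ x, f x ∂ν (Z ω)))) : ℝ) * Complex.I) =
        Complex.exp ((t * A (Z ω) : ℝ) * Complex.I) *
          Complex.exp (((t * c (Z ω)) * (√N * (empMean y f - ∫ x, f x ∂ν (Z ω))) : ℝ) *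
            Complex.I) := by
      intro y
      rw [← Complex.exp_add]
      congr 1
      push_cast
      ring
    simp only
    simp_rw [hsplit]
    rw [integral_const_mul, ← mul_sub, norm_mul, Complex.norm_exp_ofReal_mul_I, one_mul,
      ← mul_assoc (t ^ 2), ← mul_pow]
    refine norm_integral_cexp_empMean_sub_le (ν (Z ω)) hN hf hB0 hB ?_
    rw [abs_mul]
    have := hC (Z ω)
    gcongr
  · have hm' := (hm.stronglyMeasurable.integral_kernel_prod_right' (κ := piKernel N ν))
    refine Integrable.of_bound (hm'.comp_measurable h.measurable_left).aestronglyMeasurable 1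
      (ae_of_all _ fun ω => ?_)
    refine (norm_integral_le_of_norm_le_const (C := 1) (ae_of_all _ fun y => ?_)).trans (by simp)
    rw [Complex.norm_exp_ofReal_mul_I]
  · have hZ := h.measurable_left
    have h1 : Measurable fun ω => t * A (Z ω) := (hA.comp hZ).const_mul t
    have h2 : Measurable fun ω => t ^ 2 * (c (Z ω) ^ 2 *
        (∫ x, f x ^ 2 ∂ν (Z ω) - (∫ x, f x ∂ν (Z ω)) ^ 2)) / 2 :=
      ((((hc.comp hZ).pow_const 2).mul ((hν2.comp hZ).sub
        ((hν.comp hZ).pow_const 2))).const_mul _).div_const 2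
    refine Integrable.of_bound (Measurable.aestronglyMeasurable (by fun_prop)) 1
      (ae_of_all _ fun ω => ?_)
    rw [norm_mul, Complex.norm_exp_ofReal_mul_I, one_mul, ← Complex.ofReal_neg,
      ← Complex.ofReal_exp, Complex.norm_real, Real.norm_eq_abs, Real.abs_exp]
    refine Real.exp_le_one_iff.2 ?_
    have := mul_nonneg (sq_nonneg t) (mul_nonneg (sq_nonneg (c (Z ω))) (hvar (Z ω)))
    linarith

end IsCondIID

end CondIID
-- The selection-mutation transition of the particle system.
section Selection

variable {E : ℕ → Type u} [∀ p, MeasurableSpace (E p)]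
  (K : (p : ℕ) → Kernel (E p) (E (p + 1)))
  {G : (k : ℕ) → Path E k → ℝ}

lemma empMean_pos {F : Type*} {N : ℕ} (hN : 1 ≤ N) (y : Fin N → F) {g : F → ℝ}
    (hg : ∀ x, 0 < g x) : 0 < empMean y g := by
  have hN' : (0 : ℝ) < N := by exact_mod_cast hN
  have : Nonempty (Fin N) := ⟨⟨0, hN⟩⟩
  exact mul_pos (inv_pos.2 hN') (Finset.sum_pos (fun i _ => hg _) Finset.univ_nonempty)

lemma lintegral_empMeasure {F : Type u} [MeasurableSpace F] {N : ℕ} (y : Fin N → F)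
    {f : F → ℝ≥0∞} (hf : Measurable f) :
    ∫⁻ x, f x ∂empMeasure y = (N : ℝ≥0∞)⁻¹ * ∑ i, f (y i) := by
  rw [empMeasure, lintegral_smul_measure, lintegral_finsetSum_measure]
  simp_rw [lintegral_dirac' _ hf]
  rfl

/-- The factors 1/N cancel, leaving a finite mixture with weights proportional to the potentials.
Measurability in the particles, total mass one and integrals are all read off from this form. -/
lemma fkMap_empMeasure {p : ℕ} (hG : IsRegularPotential (G p)) {N : ℕ} (hN : 1 ≤ N)
    (y : Fin N → Path E p) :
    fkMap K G p (empMeasure y) =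
      ∑ i, ENNReal.ofReal (G p (y i) / ∑ j, G p (y j)) • histKernel K p (y i) := by
  have hne : Nonempty (Fin N) := ⟨⟨0, hN⟩⟩
  have hGm : Measurable fun z => ENNReal.ofReal (G p z) := hG.measurable.ennreal_ofReal
  have hsum : 0 < ∑ j, G p (y j) := Finset.sum_pos (fun i _ => hG.pos _) Finset.univ_nonempty
  have hN0 : (N : ℝ≥0∞) ≠ 0 := by simp; lia
  refine Measure.ext_of_lintegral _ fun f hf => ?_
  have hfk : Measurable fun z => ∫⁻ w, f w ∂histKernel K p z := hf.lintegral_kernel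
  rw [fkMap, lintegral_smul_measure, lintegral_empMeasure y hGm,
    Measure.lintegral_bind (Kernel.aemeasurable _) hf.aemeasurable,
    lintegral_withDensity_eq_lintegral_mul _ hGm hfk, lintegral_empMeasure y (hGm.mul hfk),
    lintegral_finsetSum_measure]
  simp_rw [lintegral_smul_measure, Pi.mul_apply]
  rw [← ENNReal.ofReal_sum_of_nonneg fun i _ => (hG.pos _).le, smul_eq_mul,
    ENNReal.mul_inv (Or.inl (by simp)) (Or.inl (by simp [hN0])), inv_inv, mul_mul_mul_comm,
    mul_comm _ (N : ℝ≥0∞)⁻¹, ENNReal.inv_mul_cancel hN0 (by simp), one_mul, Finset.mul_sum]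
  refine Finset.sum_congr rfl fun i _ => ?_
  rw [smul_eq_mul, ENNReal.ofReal_div_of_pos hsum, ← mul_assoc, ENNReal.div_eq_inv_mul]

/-- The selection-mutation transition of one particle, given the `N` particles at time `p`. -/
noncomputable def fkKernel {p : ℕ} (hG : IsRegularPotential (G p)) {N : ℕ} (hN : 1 ≤ N) :
    Kernel (Fin N → Path E p) (Path E (p + 1)) where
  toFun y := fkMap K G p (empMeasure y)
  measurable' := by
    simp_rw [fkMap_empMeasure K hG hN]
    refine Measure.measurable_of_measurable_coe _ fun s hs => ?_
    simp only [Measure.coe_finsetSum, Finset.sum_apply, Measure.smul_apply, smul_eq_mul]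
    refine Finset.measurable_sum _ fun i _ => ?_
    have hGi : ∀ j, Measurable fun y : Fin N → Path E p => G p (y j) := fun j =>
      hG.measurable.comp (measurable_pi_apply j)
    exact ((hGi i).div (Finset.measurable_sum _ fun j _ => hGi j)).ennreal_ofReal.mul
      (((histKernel K p).measurable_coe hs).comp (measurable_pi_apply i))

lemma fkKernel_apply {p : ℕ} (hG : IsRegularPotential (G p)) {N : ℕ} (hN : 1 ≤ N)
    (y : Fin N → Path E p) : fkKernel K hG hN y = fkMap K G p (empMeasure y) := rfl

variable [∀ p, IsMarkovKernel (K p)]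

lemma isMarkovKernel_fkKernel {p : ℕ} (hG : IsRegularPotential (G p)) {N : ℕ} (hN : 1 ≤ N) :
    IsMarkovKernel (fkKernel K hG hN) := by
  refine ⟨fun y => ⟨?_⟩⟩
  have hne : Nonempty (Fin N) := ⟨⟨0, hN⟩⟩
  have hsum : 0 < ∑ j, G p (y j) := Finset.sum_pos (fun i _ => hG.pos _) Finset.univ_nonempty
  rw [fkKernel_apply, fkMap_empMeasure K hG hN]
  simp only [Measure.coe_finsetSum, Finset.sum_apply, Measure.smul_apply, smul_eq_mul,
    measure_univ, mul_one]
  rw [← ENNReal.ofReal_sum_of_nonneg fun i _ => div_nonneg (hG.pos _).le hsum.le,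
    ← Finset.sum_div, div_self hsum.ne', ENNReal.ofReal_one]

/-- Multiplying by η^N(G_p) removes the normalization of the mixture. This makes the unnormalized
estimates linear, which the normalized ones are not. -/
lemma empMean_mul_integral_fkKernel {p : ℕ} (hG : IsRegularPotential (G p)) {N : ℕ} (hN : 1 ≤ N)
    {f : Path E (p + 1) → ℝ} (hf : IsBddMeas f) (y : Fin N → Path E p) :
    empMean y (G p) * ∫ z, f z ∂fkKernel K hG hN y = empMean y (fkStep K G p f) := by
  have hne : Nonempty (Fin N) := ⟨⟨0, hN⟩⟩
  have hsum : 0 < ∑ j, G p (y j) := Finset.sum_pos (fun i _ => hG.pos _) Finset.univ_nonempty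
  rw [fkKernel_apply, fkMap_empMeasure K hG hN, integral_finsetSum_measure]
  · simp_rw [integral_smul_measure]
    rw [empMean, empMean, mul_assoc, Finset.mul_sum]
    congr 1
    refine Finset.sum_congr rfl fun i _ => ?_
    rw [ENNReal.toReal_ofReal (div_nonneg (hG.pos _).le hsum.le), smul_eq_mul, fkStep, ← mul_assoc,
      mul_div_cancel₀ _ hsum.ne']
  · exact fun i _ => (hf.integrable _).smul_measure ENNReal.ofReal_ne_top

end Selection

/-! ### The unnormalized particle estimates. -/

section Estimators

variable {E : ℕ → Type u} {G : (k : ℕ) → Path E k → ℝ}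

/-- The particle estimate `γ_p^N(f) = η_p^N(f) ∏_{1 ≤ q < p} η_q^N(G_q)`. -/
noncomputable def gammaEst (G : (k : ℕ) → Path E k → ℝ) (p : ℕ) (f : Path E p → ℝ) {N : ℕ}
    {Ω : Type v} (ξ : (p : ℕ) → Ω → Fin N → Path E p) (ω : Ω) : ℝ :=
  empMean (ξ p ω) f * ∏ q ∈ Finset.Ico 1 p, empMean (ξ q ω) (G q)

/-- The estimate `γ_p^N(f)` as a function of the particles up to time `p`. -/
noncomputable def pastEst (G : (k : ℕ) → Path E k → ℝ) {p : ℕ} (hp : 1 ≤ p) (f : Path E p → ℝ)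
    {N : ℕ} (x : (q : Finset.Icc 1 p) → Fin N → Path E q) : ℝ :=
  empMean (x ⟨p, Finset.mem_Icc.2 ⟨hp, le_rfl⟩⟩) f *
    ∏ q ∈ (Finset.Ico 1 p).attach,
      empMean (x ⟨q.1, Finset.Ico_subset_Icc_self q.2⟩) (G q.1)

/-- Exhibits the estimate as a function of the conditioning variable, as required for the use of
`IsCondIID`. -/
lemma gammaEst_eq_pastEst {p : ℕ} (hp : 1 ≤ p) (f : Path E p → ℝ) {N : ℕ} {Ω : Type v}
    (ξ : (p : ℕ) → Ω → Fin N → Path E p) (ω : Ω) :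
    gammaEst G p f ξ ω = pastEst G hp f (fun q => ξ q ω) := by
  rw [gammaEst, pastEst, ← Finset.prod_attach (Finset.Ico 1 p)]

lemma gammaEst_succ {p : ℕ} (hp : 1 ≤ p) (f : Path E (p + 1) → ℝ) {N : ℕ} {Ω : Type v}
    (ξ : (p : ℕ) → Ω → Fin N → Path E p) (ω : Ω) :
    gammaEst G (p + 1) f ξ ω = gammaEst G p (G p) ξ ω * empMean (ξ (p + 1) ω) f := by
  rw [gammaEst, gammaEst, Finset.prod_Ico_succ_top hp]
  ring

variable [∀ p, MeasurableSpace (E p)]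

lemma measurable_pastEst {p : ℕ} (hp : 1 ≤ p)
    (hG : ∀ k, 1 ≤ k → k < p → IsRegularPotential (G k)) {f : Path E p → ℝ} (hf : IsBddMeas f)
    (N : ℕ) : Measurable (pastEst G hp f (N := N)) := by
  refine ((isBddMeas_empMean hf).measurable.comp (measurable_pi_apply _)).mul
    (Finset.measurable_prod _ fun q _ => ?_)
  have h := Finset.mem_Ico.1 q.2
  exact (isBddMeas_empMean (hG q.1 h.1 h.2).isBddMeas).measurable.comp
    (measurable_pi_apply (⟨q.1, Finset.Ico_subset_Icc_self q.2⟩ : Finset.Icc 1 p))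

/-- The bound does not depend on N, since empirical means inherit the sup bounds of the functions;
all error constants below rely on this uniformity. -/
lemma exists_bound_pastEst {p : ℕ} (hp : 1 ≤ p)
    (hG : ∀ k, 1 ≤ k → k < p → IsRegularPotential (G k)) {f : Path E p → ℝ} (hf : IsBddMeas f) :
    ∃ C : ℝ, 0 ≤ C ∧ ∀ (N : ℕ) (x : (q : Finset.Icc 1 p) → Fin N → Path E q),
      |pastEst G hp f x| ≤ C := by
  obtain ⟨B, hB0, hB⟩ := hf.exists_bound
  have hGb : ∀ q : Finset.Ico 1 p, ∃ C : ℝ, 0 ≤ C ∧ ∀ y, |G q y| ≤ C := fun q =>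
    (hG q.1 (Finset.mem_Ico.1 q.2).1 (Finset.mem_Ico.1 q.2).2).isBddMeas.exists_bound
  choose C hC0 hC using hGb
  refine ⟨B * ∏ q ∈ (Finset.Ico 1 p).attach, C q,
    mul_nonneg hB0 (Finset.prod_nonneg fun q _ => hC0 q), fun N x => ?_⟩
  rw [pastEst, abs_mul, Finset.abs_prod]
  exact mul_le_mul (abs_empMean_le hB0 hB _)
    (Finset.prod_le_prod (fun _ _ => abs_nonneg _) fun q _ => abs_empMean_le (hC0 q) (hC q) _)
    (Finset.prod_nonneg fun _ _ => abs_nonneg _) hB0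

lemma pastEst_mul_integral_fkKernel (K : (p : ℕ) → Kernel (E p) (E (p + 1)))
    [∀ p, IsMarkovKernel (K p)] {p : ℕ} (hp : 1 ≤ p) (hG : IsRegularPotential (G p)) {N : ℕ}
    (hN : 1 ≤ N) {f : Path E (p + 1) → ℝ} (hf : IsBddMeas f)
    (x : (q : Finset.Icc 1 p) → Fin N → Path E q) :
    pastEst G hp (G p) x *
        ∫ z, f z ∂fkKernel K hG hN (x ⟨p, Finset.mem_Icc.2 ⟨hp, le_rfl⟩⟩) =
      pastEst G hp (fkStep K G p f) x := by
  rw [pastEst, pastEst, ← empMean_mul_integral_fkKernel K hG hN hf]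
  ring

end Estimators

/-! ### Conditional independence in the particle model and unbiasedness. -/

namespace IsParticleModel

variable {E : ℕ → Type u} [∀ p, MeasurableSpace (E p)]
  {K : (p : ℕ) → Kernel (E p) (E (p + 1))} {x₀ : E 0}
  {G : (k : ℕ) → Path E k → ℝ} {n N : ℕ} {Ω : Type v} [MeasurableSpace Ω] {μ : Measure Ω}
  {ξ : (p : ℕ) → Ω → Fin N → Path E p}

lemma measurable_past (h : IsParticleModel K x₀ G n N μ ξ) {p : ℕ} (hpn : p ≤ n) :
    Measurable fun ω => fun q : Finset.Icc 1 p => ξ q ω :=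
  measurable_pi_lambda _ fun q =>
    h.measurable q (Finset.mem_Icc.1 q.2).1 ((Finset.mem_Icc.1 q.2).2.trans hpn)

lemma isBddMeas_gammaEst (h : IsParticleModel K x₀ G n N μ ξ) {p : ℕ} (hp : 1 ≤ p) (hpn : p ≤ n)
    (hG : ∀ k, 1 ≤ k → k < n → IsRegularPotential (G k)) {f : Path E p → ℝ} (hf : IsBddMeas f) :
    IsBddMeas (gammaEst G p f ξ) := by
  have hG' : ∀ k, 1 ≤ k → k < p → IsRegularPotential (G k) :=
    fun k h1 h2 => hG k h1 (h2.trans_le hpn)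
  obtain ⟨C, -, hC⟩ := exists_bound_pastEst hp hG' hf
  have := IsBddMeas.comp ⟨measurable_pastEst hp hG' hf N, C, hC N⟩ (h.measurable_past hpn)
  simpa only [← gammaEst_eq_pastEst] using this

/-- A one-point conditioning variable lets the first generation be handled by the same estimates as
the later ones. -/
lemma isCondIID_initial [IsProbabilityMeasure μ] (h : IsParticleModel K x₀ G n N μ ξ) (hn : 1 ≤ n) :
    IsCondIID μ (fun _ => ()) (ξ 1) (Kernel.const Unit (histKernel K 0 (initPath x₀))) where
  measurable_left := measurable_const
  measurable_right := h.measurable 1 le_rfl hn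
  lintegral_eq f hf := by
    have hf' : Measurable fun y : Fin N → Path E 1 => f ((), y) := hf.comp measurable_prodMk_left
    simp only [Kernel.const_apply, lintegral_const, measure_univ, mul_one]
    rw [← h.initial, lintegral_map hf' (h.measurable 1 le_rfl hn)]

lemma isCondIID_succ (h : IsParticleModel K x₀ G n N μ ξ) {p : ℕ} (hp : 1 ≤ p) (hpn : p < n)
    (hG : IsRegularPotential (G p)) (hN : 1 ≤ N) :
    IsCondIID μ (fun ω => fun q : Finset.Icc 1 p => ξ q ω) (ξ (p + 1))
      ((fkKernel K hG hN).comap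
        (fun x : (q : Finset.Icc 1 p) → Fin N → Path E q =>
          x ⟨p, Finset.mem_Icc.2 ⟨hp, le_rfl⟩⟩) (measurable_pi_apply _)) where
  measurable_left := h.measurable_past hpn.le
  measurable_right := h.measurable (p + 1) (by lia) hpn
  lintegral_eq f hf := h.transition p hp hpn f hf

variable [∀ p, IsMarkovKernel (K p)] [IsProbabilityMeasure μ]

/-- The estimates `γ_p^N(f)` are unbiased. -/
lemma integral_gammaEst (h : IsParticleModel K x₀ G n N μ ξ)
    (hG : ∀ k, 1 ≤ k → k < n → IsRegularPotential (G k)) (hN : 1 ≤ N) {p : ℕ} (hp : 1 ≤ p) (hpn : p ≤ n) {f : Path E p → ℝ}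
    (hf : IsBddMeas f) : ∫ ω, gammaEst G p f ξ ω ∂μ = gammaFlow K x₀ G p f := by
  induction p, hp using Nat.le_induction with
  | base =>
    have := (h.isCondIID_initial hpn).integral_mul_empMean hN (IsBddMeas.const 1) hf
    rw [gammaFlow_one K x₀ hf.measurable]
    simpa [gammaEst] using this
  | succ p hp ih =>
    have hGp := hG p hp hpn
    have hG' : ∀ k, 1 ≤ k → k < p → IsRegularPotential (G k) :=
      fun k h1 h2 => hG k h1 (h2.trans hpn)
    have hm := isMarkovKernel_fkKernel K hGp hN
    obtain ⟨C, -, hC⟩ := exists_bound_pastEst hp hG' hGp.isBddMeas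
    rw [gammaFlow_succ K x₀ hp (fun k h1 h2 => hG k h1 (by lia)) hf,
      ← ih (by lia) (isBddMeas_fkStep K hGp hf)]
    have := (h.isCondIID_succ hp hpn hGp hN).integral_mul_empMean hN
      ⟨measurable_pastEst hp hG' hGp.isBddMeas N, C, hC N⟩ hf
    simp only [Kernel.comap_apply, pastEst_mul_integral_fkKernel K hp hGp hN hf] at this
    simp only [gammaEst_succ hp]
    simpa only [gammaEst_eq_pastEst hp] using this

end IsParticleModel
-- Error bounds and the central limit theorem for the estimates.
section Asymptotics

variable {E : ℕ → Type u} [∀ p, MeasurableSpace (E p)]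
  (K : (p : ℕ) → Kernel (E p) (E (p + 1))) [∀ p, IsMarkovKernel (K p)] (x₀ : E 0)
  {G : (k : ℕ) → Path E k → ℝ} {n : ℕ}
  {Ω : ℕ → Type v} [∀ N, MeasurableSpace (Ω N)] {μ : (N : ℕ) → Measure (Ω N)}
  [∀ N, IsProbabilityMeasure (μ N)] {ξ : (N : ℕ) → (p : ℕ) → Ω N → Fin N → Path E p}

/-- The estimates `γ_p^N(f)` have mean square error `O(1 / N)`. -/
lemma exists_integral_sq_gammaEst_sub_le
    (hξ : ∀ N, 1 ≤ N → IsParticleModel K x₀ G n N (μ N) (ξ N))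
    (hG : ∀ k, 1 ≤ k → k < n → IsRegularPotential (G k)) {p : ℕ} (hp : 1 ≤ p) (hpn : p ≤ n)
    {f : Path E p → ℝ} (hf : IsBddMeas f) :
    ∃ C : ℝ, 0 ≤ C ∧ ∀ N, 1 ≤ N →
      ∫ ω, (gammaEst G p f (ξ N) ω - gammaFlow K x₀ G p f) ^ 2 ∂μ N ≤ C / N := by
  induction p, hp using Nat.le_induction with
  | base =>
    obtain ⟨B, hB0, hB⟩ := hf.exists_bound
    refine ⟨1 ^ 2 * (2 * B) ^ 2, by positivity, fun N hN => ?_⟩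
    have := ((hξ N hN).isCondIID_initial hpn).integral_sq_error_le hN (measurable_const (a := 1))
      (C := 1) (by simp) hf.measurable hB0 hB
    rw [gammaFlow_one K x₀ hf.measurable]
    simpa [gammaEst] using this
  | succ p hp ih =>
    have hGp := hG p hp hpn
    have hG' : ∀ k, 1 ≤ k → k < p → IsRegularPotential (G k) :=
      fun k h1 h2 => hG k h1 (h2.trans hpn)
    have hQ := isBddMeas_fkStep K hGp hf
    obtain ⟨B, hB0, hB⟩ := hf.exists_bound
    obtain ⟨C, hC0, hC⟩ := exists_bound_pastEst hp hG' hGp.isBddMeas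
    obtain ⟨D, hD0, hD⟩ := ih (by lia) hQ
    -- The error is split at γ_p^N(Qf), using (x + y)² ≤ 2x² + 2y²: the first term bounds the
    -- sampling error, the second is the induction hypothesis for Qf.
    refine ⟨2 * (C ^ 2 * (2 * B) ^ 2) + 2 * D, by positivity, fun N hN => ?_⟩
    have hm := isMarkovKernel_fkKernel K hGp hN
    have hiid := (hξ N hN).isCondIID_succ hp hpn hGp hN
    have hcb : IsBddMeas (pastEst G hp (G p) (N := N)) :=
      ⟨measurable_pastEst hp hG' hGp.isBddMeas N, C, hC N⟩
    have herr := hiid.integral_sq_error_le hN hcb.measurable (hC N) hf.measurable hB0 hB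
    have hint := ((hiid.isBddMeas_error_comp hcb hf).pow 2).integrable (μ N)
    have hint2 := ((((hξ N hN).isBddMeas_gammaEst hp (by lia) hG hQ).sub
      (IsBddMeas.const (gammaFlow K x₀ G p (fkStep K G p f)))).pow 2).integrable (μ N)
    rw [gammaFlow_succ K x₀ hp (fun k h1 h2 => hG k h1 (by lia)) hf]
    calc ∫ ω, (gammaEst G (p + 1) f (ξ N) ω - gammaFlow K x₀ G p (fkStep K G p f)) ^ 2 ∂μ N
        ≤ ∫ ω, (2 * _ + 2 * _) ∂μ N := by
          refine integral_mono_of_nonneg (ae_of_all _ fun ω => sq_nonneg _)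
            ((hint.const_mul 2).add (hint2.const_mul 2)) (ae_of_all _ fun ω => ?_)
          simp only [Kernel.comap_apply, mul_sub, pastEst_mul_integral_fkKernel K hp hGp hN hf]
          rw [gammaEst_succ hp, gammaEst_eq_pastEst hp, gammaEst_eq_pastEst hp]
          set a := pastEst G hp (G p) (fun q : Finset.Icc 1 p => ξ N q ω) *
            empMean (ξ N (p + 1) ω) f
          set b := pastEst G hp (fkStep K G p f) (fun q : Finset.Icc 1 p => ξ N q ω)
          nlinarith [sq_nonneg ((a - b) - (b - gammaFlow K x₀ G p (fkStep K G p f)))]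
      _ ≤ 2 * (C ^ 2 * (2 * B) ^ 2 / N) + 2 * (D / N) := by
          rw [integral_add (hint.const_mul 2) (hint2.const_mul 2), integral_const_mul,
            integral_const_mul]
          have := hD N hN
          gcongr
      _ = (2 * (C ^ 2 * (2 * B) ^ 2) + 2 * D) / N := by ring

/-- A weighted arithmetic-geometric inequality. The weight √N turns a mean square of order 1/N into
a mean of order 1/√N. -/
lemma abs_le_sqrt_mul_sq_add (x : ℝ) {N : ℕ} (hN : 1 ≤ N) : |x| ≤ √N * x ^ 2 + 1 / √N := by
  have hs : 0 < √(N : ℝ) := Real.sqrt_pos.2 (by exact_mod_cast hN)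
  rw [← sq_abs x, ← sub_nonneg]
  have : √(N : ℝ) * |x| ^ 2 + 1 / √N - |x| =
      ((√N * |x| - 1 / 2) ^ 2 + 3 / 4) / √N := by
    field_simp
    ring
  rw [this]
  positivity

/-- The estimates `γ_p^N(f)` have mean absolute error `O(1 / √N)`. -/
lemma exists_integral_abs_gammaEst_sub_le
    (hξ : ∀ N, 1 ≤ N → IsParticleModel K x₀ G n N (μ N) (ξ N))
    (hG : ∀ k, 1 ≤ k → k < n → IsRegularPotential (G k)) {p : ℕ} (hp : 1 ≤ p) (hpn : p ≤ n)
    {f : Path E p → ℝ} (hf : IsBddMeas f) :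
    ∃ C : ℝ, 0 ≤ C ∧ ∀ N, 1 ≤ N →
      ∫ ω, |gammaEst G p f (ξ N) ω - gammaFlow K x₀ G p f| ∂μ N ≤ C / √N := by
  obtain ⟨C, hC0, hC⟩ := exists_integral_sq_gammaEst_sub_le K x₀ hξ hG hp hpn hf
  refine ⟨C + 1, by positivity, fun N hN => ?_⟩
  have hs : 0 < √(N : ℝ) := Real.sqrt_pos.2 (by exact_mod_cast hN)
  have hint := ((((hξ N hN).isBddMeas_gammaEst hp hpn hG hf).sub
      (IsBddMeas.const (gammaFlow K x₀ G p f))).pow 2).integrable (μ N)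
  calc _ ≤ ∫ ω, (√N * (gammaEst G p f (ξ N) ω - gammaFlow K x₀ G p f) ^ 2 + 1 / √N) ∂μ N :=
        integral_mono_of_nonneg (ae_of_all _ fun ω => abs_nonneg _)
          ((hint.const_mul _).add (integrable_const _))
          (ae_of_all _ fun ω => abs_le_sqrt_mul_sq_add _ hN)
    _ ≤ √N * (C / N) + 1 / √N := by
        rw [integral_add (hint.const_mul _) (integrable_const _), integral_const_mul]
        have := hC N hN
        simp only [integral_const, probReal_univ, one_smul]
        gcongr
    _ = (C + 1) / √N := by
        have : (N : ℝ) = √N * √N := (Real.mul_self_sqrt (Nat.cast_nonneg N)).symm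
        rw [add_div]
        congr 1
        conv_lhs => rw [this, Real.sqrt_mul_self hs.le]
        field_simp

variable (G) in
/-- The asymptotic variance of `√N (γ_p^N(f) - γ_p(f))`. -/
noncomputable def asympVar : (p : ℕ) → (Path E p → ℝ) → ℝ
  -- The value at 0 only stops the recursion. At time 1 just the variance of the initial sampling
  -- remains, whatever G_0 is.
  | 0, _ => 0
  | p + 1, f =>
    gammaFlow K x₀ G (p + 1) (fun _ => 1) * gammaFlow K x₀ G (p + 1) (fun y => f y ^ 2) -
      gammaFlow K x₀ G (p + 1) f ^ 2 + asympVar p (fkStep K G p f)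

lemma abs_exp_neg_sub_exp_neg_le {x y : ℝ} (hx : 0 ≤ x) (hy : 0 ≤ y) :
    |Real.exp (-x) - Real.exp (-y)| ≤ |x - y| := by
  wlog hxy : x ≤ y generalizing x y
  · rw [abs_sub_comm, abs_sub_comm x]
    exact this hy hx (le_of_not_ge hxy)
  have h1 : Real.exp (-y) ≤ Real.exp (-x) := Real.exp_le_exp.2 (by linarith)
  rw [abs_of_nonneg (by linarith), abs_of_nonpos (by linarith)]
  have h2 : Real.exp (-y) = Real.exp (-x) * Real.exp (-(y - x)) := by
    rw [← Real.exp_add]; congr 1; ring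
  have h3 := Real.add_one_le_exp (-(y - x))
  have h4 : Real.exp (-x) ≤ 1 := Real.exp_le_one_iff.2 (by linarith)
  have h5 := Real.exp_pos (-x)
  rw [h2]
  nlinarith

lemma tendsto_const_div_sqrt (C : ℝ) : Tendsto (fun N : ℕ => C / √(N : ℝ)) atTop (𝓝 0) :=
  tendsto_const_nhds.div_atTop
    (Real.tendsto_sqrt_atTop.comp tendsto_natCast_atTop_atTop)

/-- The conditional variance of the sampling error at time `p + 1` converges in mean. -/
lemma exists_integral_abs_condVar_sub_le
    (hξ : ∀ N, 1 ≤ N → IsParticleModel K x₀ G n N (μ N) (ξ N))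
    (hG : ∀ k, 1 ≤ k → k < n → IsRegularPotential (G k)) {p : ℕ} (hp : 1 ≤ p) (hpn : p ≤ n)
    {c f g : Path E p → ℝ} (hc : IsBddMeas c) (hf : IsBddMeas f) (hg : IsBddMeas g) :
    ∃ C : ℝ, 0 ≤ C ∧ ∀ N, 1 ≤ N →
      ∫ ω, |(gammaEst G p c (ξ N) ω * gammaEst G p f (ξ N) ω - gammaEst G p g (ξ N) ω ^ 2) -
        (gammaFlow K x₀ G p c * gammaFlow K x₀ G p f - gammaFlow K x₀ G p g ^ 2)| ∂μ N ≤
          C / √N := by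
  have hG' : ∀ k, 1 ≤ k → k < p → IsRegularPotential (G k) :=
    fun k h1 h2 => hG k h1 (h2.trans_le hpn)
  obtain ⟨Cc, hCc0, hCc⟩ := exists_integral_abs_gammaEst_sub_le K x₀ hξ hG hp hpn hc
  obtain ⟨Cf, hCf0, hCf⟩ := exists_integral_abs_gammaEst_sub_le K x₀ hξ hG hp hpn hf
  obtain ⟨Cg, hCg0, hCg⟩ := exists_integral_abs_gammaEst_sub_le K x₀ hξ hG hp hpn hg
  obtain ⟨Bf, hBf0, hBf⟩ := exists_bound_pastEst hp hG' hf
  obtain ⟨Bg, hBg0, hBg⟩ := exists_bound_pastEst hp hG' hg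
  set γc := gammaFlow K x₀ G p c
  set γf := gammaFlow K x₀ G p f
  set γg := gammaFlow K x₀ G p g
  refine ⟨Bf * Cc + |γc| * Cf + (Bg + |γg|) * Cg, by positivity, fun N hN => ?_⟩
  have hi : ∀ {f : Path E p → ℝ} (_ : IsBddMeas f) (a : ℝ),
      Integrable (fun ω => |gammaEst G p f (ξ N) ω - a|) (μ N) := fun hf a =>
    ((((hξ N hN).isBddMeas_gammaEst hp hpn hG hf).sub (IsBddMeas.const a)).integrable (μ N)).abs
  have i1 := (hi hc γc).const_mul Bf
  have i2 := (hi hf γf).const_mul |γc|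
  have i3 := (hi hg γg).const_mul (Bg + |γg|)
  have i12 : Integrable (fun ω => Bf * |gammaEst G p c (ξ N) ω - γc| +
      |γc| * |gammaEst G p f (ξ N) ω - γf|) (μ N) := i1.add i2
  calc _ ≤ ∫ ω, (Bf * |gammaEst G p c (ξ N) ω - γc| + |γc| * |gammaEst G p f (ξ N) ω - γf| +
        (Bg + |γg|) * |gammaEst G p g (ξ N) ω - γg|) ∂μ N := by
        refine integral_mono_of_nonneg (ae_of_all _ fun ω => abs_nonneg _) (i12.add i3)
          (ae_of_all _ fun ω => ?_)
        simp only
        have h1 : |gammaEst G p f (ξ N) ω| ≤ Bf := by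
          rw [gammaEst_eq_pastEst hp]; exact hBf N _
        have h2 : |gammaEst G p g (ξ N) ω| ≤ Bg := by
          rw [gammaEst_eq_pastEst hp]; exact hBg N _
        generalize gammaEst G p c (ξ N) ω = a at *
        generalize gammaEst G p f (ξ N) ω = b at *
        generalize gammaEst G p g (ξ N) ω = d at *
        -- Each of the three errors is multiplied by a factor bounded uniformly in N, which gives
        -- the constants chosen above.
        have e : a * b - d ^ 2 - (γc * γf - γg ^ 2) =
          b * (a - γc) + γc * (b - γf) - (d + γg) * (d - γg) := by ring
        rw [e]
        refine (abs_sub _ _).trans (add_le_add ((abs_add_le _ _).trans (add_le_add ?_ ?_)) ?_)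
        · rw [abs_mul]; gcongr
        · rw [abs_mul]
        · rw [abs_mul]
          gcongr
          exact (abs_add_le _ _).trans (by gcongr)
    _ ≤ Bf * (Cc / √N) + |γc| * (Cf / √N) + (Bg + |γg|) * (Cg / √N) := by
        rw [integral_add i12 i3, integral_add i1 i2, integral_const_mul,
          integral_const_mul, integral_const_mul]
        have := hCc N hN
        have := hCf N hN
        have := hCg N hN
        gcongr
    _ = _ := by ring

lemma fkStep_one (p : ℕ) : fkStep K G p (fun _ => 1) = G p := by
  funext y
  simp [fkStep]

/-- Central limit theorem for `γ_p^N(f)`, at the level of characteristic functions. -/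
lemma tendsto_integral_cexp_gammaEst
    (hξ : ∀ N, 1 ≤ N → IsParticleModel K x₀ G n N (μ N) (ξ N))
    (hG : ∀ k, 1 ≤ k → k < n → IsRegularPotential (G k)) {p : ℕ} (hp : 1 ≤ p) (hpn : p ≤ n)
    {f : Path E p → ℝ} (hf : IsBddMeas f) (t : ℝ) :
    Tendsto (fun N : ℕ => ∫ ω, Complex.exp ((t * (√N *
        (gammaEst G p f (ξ N) ω - gammaFlow K x₀ G p f)) : ℝ) * Complex.I) ∂μ N) atTop
      (𝓝 (Complex.exp (-(t ^ 2 * asympVar K x₀ G p f / 2 : ℝ)))) := by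
  induction p, hp using Nat.le_induction with
  | base =>
    obtain ⟨B, hB0, hB⟩ := hf.exists_bound
    rw [tendsto_iff_norm_sub_tendsto_zero]
    refine squeeze_zero_norm' ?_ (tendsto_const_div_sqrt (charConst (|t| * 1 * (2 * B))))
    filter_upwards [eventually_ge_atTop 1] with N hN
    rw [norm_norm]
    have := ((hξ N hN).isCondIID_initial hpn).norm_integral_cexp_sub_le hN
      (measurable_const (a := (1 : ℝ))) (C := 1) (by simp) hf.measurable hB0 hB
      (measurable_const (a := (0 : ℝ))) t
    rw [asympVar, asympVar, gammaFlow_one K x₀ hf.measurable,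
      gammaFlow_one K x₀ (hf.pow 2).measurable, gammaFlow_one K x₀ measurable_const]
    simpa [gammaEst] using this
  | succ p hp ih =>
    have hGp := hG p hp hpn
    have hG' : ∀ k, 1 ≤ k → k < p → IsRegularPotential (G k) :=
      fun k h1 h2 => hG k h1 (h2.trans hpn)
    have hG'' : ∀ k, 1 ≤ k → k < p + 1 → IsRegularPotential (G k) :=
      fun k h1 h2 => hG k h1 (by lia)
    have hQ := isBddMeas_fkStep K hGp hf
    have hQ2 := isBddMeas_fkStep K hGp (hf.pow 2)
    obtain ⟨B, hB0, hB⟩ := hf.exists_bound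
    obtain ⟨C, hC0, hC⟩ := exists_bound_pastEst hp hG' hGp.isBddMeas
    obtain ⟨D, hD0, hD⟩ := exists_integral_abs_condVar_sub_le K x₀ hξ hG hp (by lia)
      hGp.isBddMeas hQ2 hQ
    set Q := fkStep K G p f with hQdef
    set v := gammaFlow K x₀ G p (G p) * gammaFlow K x₀ G p (fkStep K G p fun y => f y ^ 2) -
      gammaFlow K x₀ G p Q ^ 2 with hv
    have hflow := gammaFlow_succ K x₀ hp hG'' hf
    have hvar : asympVar K x₀ G (p + 1) f = v + asympVar K x₀ G p Q := by
      rw [asympVar, hflow, gammaFlow_succ K x₀ hp hG'' (hf.pow 2),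
        gammaFlow_succ K x₀ hp hG'' (IsBddMeas.const 1), fkStep_one]
    set W : (N : ℕ) → Ω N → ℝ := fun N ω =>
      gammaEst G p (G p) (ξ N) ω * gammaEst G p (fkStep K G p fun y => f y ^ 2) (ξ N) ω -
        gammaEst G p Q (ξ N) ω ^ 2 with hW
    -- W is γ_p^N(G_p)² times the variance of f under the sampling law.
    have hWnn : ∀ N, 1 ≤ N → ∀ ω, 0 ≤ W N ω := by
      intro N hN ω
      have hm := isMarkovKernel_fkKernel K hGp hN
      simp only [hW, gammaEst_eq_pastEst hp, hQdef]
      set x := fun q : Finset.Icc 1 p => ξ N q ω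
      rw [← pastEst_mul_integral_fkKernel K hp hGp hN hf,
        ← pastEst_mul_integral_fkKernel K hp hGp hN (hf.pow 2)]
      set ν := fkKernel K hGp hN (x ⟨p, Finset.mem_Icc.2 ⟨hp, le_rfl⟩⟩)
      have h1 := variance_nonneg f ν
      rw [variance_eq_sub (MemLp.of_bound hf.measurable.aestronglyMeasurable B
        (ae_of_all _ hB))] at h1
      have h2 := mul_nonneg (sq_nonneg (pastEst G hp (G p) x)) h1
      simp only [Pi.pow_apply] at h2
      linarith
    have hWb : ∀ N, 1 ≤ N → IsBddMeas (W N) := fun N hN =>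
      (((hξ N hN).isBddMeas_gammaEst hp (by lia) hG hGp.isBddMeas).mul
        ((hξ N hN).isBddMeas_gammaEst hp (by lia) hG hQ2)).sub
        (((hξ N hN).isBddMeas_gammaEst hp (by lia) hG hQ).pow 2)
    -- v is the limit of the means of the nonnegative variables W, with error at most D/√N.
    have hvnn : 0 ≤ v := by
      refine ge_of_tendsto (x := atTop) (f := fun N : ℕ => v + D / √(N : ℝ)) ?_ ?_
      · simpa using tendsto_const_nhds.add (tendsto_const_div_sqrt D)
      · filter_upwards [eventually_ge_atTop 1] with N hN
        have h1 := hD N hN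
        have h2 : |∫ ω, (W N ω - v) ∂μ N| ≤ ∫ ω, |W N ω - v| ∂μ N := abs_integral_le_integral_abs
        rw [integral_sub ((hWb N hN).integrable _) (integrable_const _)] at h2
        have h3 : 0 ≤ ∫ ω, W N ω ∂μ N := integral_nonneg (hWnn N hN)
        have h4 := neg_abs_le (∫ ω, W N ω ∂μ N - ∫ ω, v ∂μ N)
        have h5 := le_abs_self (∫ ω, W N ω ∂μ N - ∫ ω, v ∂μ N)
        simp only [integral_const, probReal_univ, one_smul] at h2 h4 h5
        linarith
    -- The induction hypothesis for Qf times the Gaussian factor of the new generation is the target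
    -- limit. It remains to show that the two sequences differ by O(1/√N).
    have hlim := (ih (by lia) hQ).mul_const (Complex.exp (-(t ^ 2 * v / 2 : ℝ)))
    rw [← Complex.exp_add, ← neg_add, ← Complex.ofReal_add, ← add_div, ← mul_add, add_comm,
      ← hvar] at hlim
    refine (tendsto_iff_of_dist ?_).2 hlim
    refine squeeze_zero_norm' ?_
      (tendsto_const_div_sqrt (charConst (|t| * C * (2 * B)) + t ^ 2 / 2 * D))
    filter_upwards [eventually_ge_atTop 1] with N hN
    rw [Real.norm_of_nonneg dist_nonneg, dist_eq_norm]
    have hm := isMarkovKernel_fkKernel K hGp hN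
    have hiid := (hξ N hN).isCondIID_succ hp hpn hGp hN
    have hA : Measurable fun x : (q : Finset.Icc 1 p) → Fin N → Path E q =>
        √N * (pastEst G hp Q x - gammaFlow K x₀ G p Q) :=
      ((measurable_pastEst hp hG' hQ N).sub_const _).const_mul _
    have hmain := hiid.norm_integral_cexp_sub_le hN
      (measurable_pastEst hp hG' hGp.isBddMeas N) (hC N) hf.measurable hB0 hB hA t
    have e1 : ∀ ω, √N * (pastEst G hp Q (fun q : Finset.Icc 1 p => ξ N q ω) -
        gammaFlow K x₀ G p Q) + √N * (pastEst G hp (G p) (fun q : Finset.Icc 1 p => ξ N q ω) *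
        (empMean (ξ N (p + 1) ω) f -
          ∫ z, f z ∂fkKernel K hGp hN (ξ N p ω))) =
        √N * (gammaEst G (p + 1) f (ξ N) ω - gammaFlow K x₀ G (p + 1) f) := by
      intro ω
      rw [hflow, gammaEst_succ hp, gammaEst_eq_pastEst hp,
        mul_sub (pastEst G hp (G p) _), pastEst_mul_integral_fkKernel K hp hGp hN hf
          (fun q : Finset.Icc 1 p => ξ N q ω)]
      ring
    have e2 : ∀ ω, pastEst G hp (G p) (fun q : Finset.Icc 1 p => ξ N q ω) ^ 2 *
        (∫ z, f z ^ 2 ∂fkKernel K hGp hN (ξ N p ω) -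
          (∫ z, f z ∂fkKernel K hGp hN (ξ N p ω)) ^ 2) = W N ω := by
      intro ω
      simp only [hW, gammaEst_eq_pastEst hp, hQdef]
      rw [← pastEst_mul_integral_fkKernel K hp hGp hN hf,
        ← pastEst_mul_integral_fkKernel K hp hGp hN (hf.pow 2)]
      ring
    simp only [Kernel.comap_apply, e1, e2] at hmain
    simp only [← gammaEst_eq_pastEst hp] at hmain
    have hAm : Measurable fun ω => t * (√N * (gammaEst G p Q (ξ N) ω - gammaFlow K x₀ G p Q)) :=
      ((((hξ N hN).isBddMeas_gammaEst hp (by lia) hG hQ).measurable.sub_const _).const_mul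
        _).const_mul t
    have hWm := (hWb N hN).measurable
    -- Replacing the random variance W by v: the oscillating factor has modulus one and r ↦ exp(-r)
    -- is 1-Lipschitz on r ≥ 0, so the cost is controlled by the mean of |W - v|.
    have hsecond : ‖∫ ω, Complex.exp ((t * (√N * (gammaEst G p Q (ξ N) ω -
          gammaFlow K x₀ G p Q)) : ℝ) * Complex.I) *
          Complex.exp (-(t ^ 2 * W N ω / 2 : ℝ)) ∂μ N -
        (∫ ω, Complex.exp ((t * (√N * (gammaEst G p Q (ξ N) ω -
          gammaFlow K x₀ G p Q)) : ℝ) * Complex.I) ∂μ N) *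
          Complex.exp (-(t ^ 2 * v / 2 : ℝ))‖ ≤ t ^ 2 / 2 * (D / √N) := by
      have hexp : ∀ r : ℝ, Complex.exp (-(r : ℂ)) = (Real.exp (-r) : ℂ) := fun r => by
        push_cast; rfl
      simp only [hexp]
      rw [← integral_mul_const, ← integral_sub]
      · refine (norm_integral_le_integral_norm _).trans ?_
        have hWi : Integrable (fun ω => |W N ω - v|) (μ N) :=
          (((hWb N hN).sub (IsBddMeas.const v)).integrable _).abs
        calc _ ≤ ∫ ω, t ^ 2 / 2 * |W N ω - v| ∂μ N := by
              refine integral_mono_of_nonneg (ae_of_all _ fun ω => norm_nonneg _)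
                (hWi.const_mul _) (ae_of_all _ fun ω => ?_)
              simp only
              rw [← mul_sub, norm_mul, Complex.norm_exp_ofReal_mul_I, one_mul, ← Complex.ofReal_sub,
                Complex.norm_real, Real.norm_eq_abs]
              have := hWnn N hN ω
              refine (abs_exp_neg_sub_exp_neg_le (by positivity) (by positivity)).trans (le_of_eq ?_)
              rw [← sub_div, ← mul_sub, abs_div, abs_mul, abs_of_nonneg (sq_nonneg t),
                abs_of_pos (two_pos : (0 : ℝ) < 2)]
              ring
          _ ≤ _ := by
              rw [integral_const_mul]
              exact mul_le_mul_of_nonneg_left (hD N hN) (by positivity)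
      · refine Integrable.of_bound (Measurable.aestronglyMeasurable (by fun_prop)) 1
          (ae_of_all _ fun ω => ?_)
        rw [norm_mul, Complex.norm_exp_ofReal_mul_I, one_mul, Complex.norm_real, Real.norm_eq_abs,
          Real.abs_exp]
        have := hWnn N hN ω
        exact Real.exp_le_one_iff.2 (neg_nonpos.2 (by positivity))
      · refine (Integrable.of_bound (Measurable.aestronglyMeasurable (by fun_prop)) 1
          (ae_of_all _ fun ω => ?_)).mul_const _
        rw [Complex.norm_exp_ofReal_mul_I]
    calc _ ≤ _ := norm_sub_le_norm_sub_add_norm_sub _ _ _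
      _ ≤ charConst (|t| * C * (2 * B)) / √N + t ^ 2 / 2 * (D / √N) := add_le_add hmain hsecond
      _ = _ := by ring

end Asymptotics
-- Conditional expectations given the past of the chain.
section Projection

variable {E : ℕ → Type u} [∀ p, MeasurableSpace (E p)]
  (K : (p : ℕ) → Kernel (E p) (E (p + 1)))

/-- The function `y ↦ 𝔼[ψ(Y_q) | Y_p = y]`. -/
noncomputable def project (p q : ℕ) (ψ : Path E q → ℝ) (y : Path E p) : ℝ :=
  ∫ z, ψ z ∂Kernel.partialTraj (stepKernel K) p q y

lemma project_self {p : ℕ} {ψ : Path E p → ℝ} (hψ : Measurable ψ) : project K p p ψ = ψ := by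
  funext y
  rw [project, Kernel.partialTraj_self, Kernel.id_apply, integral_dirac' _ _ hψ.stronglyMeasurable]

variable [∀ p, IsMarkovKernel (K p)] (x₀ : E 0)

variable {K} in
lemma isBddMeas_project {p q : ℕ} {ψ : Path E q → ℝ} (hψ : IsBddMeas ψ) :
    IsBddMeas (project K p q ψ) :=
  hψ.integral_kernel _

lemma project_succ {p q : ℕ} (hpq : p ≤ q) {ψ : Path E (q + 1) → ℝ} (hψ : IsBddMeas ψ) :
    project K p (q + 1) ψ = project K p q (fun y => ∫ z, ψ z ∂histKernel K q y) := by
  funext y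
  rw [project, Kernel.partialTraj_succ_eq_comp hpq, Kernel.integral_comp (hψ.integrable _)]
  rfl

/-- Markov property, obtained by peeling off the last transition. It reconciles conditioning on X_p
alone with conditioning on the whole path. -/
lemma exists_project_endpoint {p q : ℕ} (hpq : p ≤ q) {w : E q → ℝ} (hw : IsBddMeas w) :
    ∃ r : E p → ℝ, Measurable r ∧
      ∀ y, project K p q (fun z => w (endpoint z)) y = r (endpoint y) := by
  induction q, hpq using Nat.le_induction with
  | base =>
    exact ⟨w, hw.measurable, fun y => by
      rw [project_self K (hw.comp (measurable_endpoint _)).measurable]⟩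
  | succ q hpq ih =>
    obtain ⟨r, hr, h⟩ := ih (hw.integral_kernel (K q))
    refine ⟨r, hr, fun y => ?_⟩
    rw [project_succ K hpq (hw.comp (measurable_endpoint _)), ← h y]
    simp_rw [integral_histKernel_endpoint K hw.measurable]

/-- The characterizing identity of a conditional expectation: u depends only on the past, so it
passes through the transition from p to q. -/
lemma integral_mul_project {p q : ℕ} (hpq : p ≤ q) {u : Path E p → ℝ} (hu : IsBddMeas u)
    {ψ : Path E q → ℝ} (hψ : IsBddMeas ψ) :
    ∫ x, u (frestrictLe p x) * project K p q ψ (frestrictLe p x) ∂chainLaw K x₀ =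
      ∫ x, u (frestrictLe p x) * ψ (frestrictLe q x) ∂chainLaw K x₀ := by
  have h1 := integral_chainLaw K x₀ (hu.mul (isBddMeas_project (K := K) (p := p) hψ)).measurable
  have h2 := integral_chainLaw K x₀
    ((hu.comp (measurable_frestrictLe₂ hpq)).mul hψ).measurable
  rw [integral_pathLaw_partialTraj K x₀ hpq ((hu.comp (measurable_frestrictLe₂ hpq)).mul hψ)] at h2
  simp only [integral_partialTraj_mul K hpq hu.measurable] at h2
  exact h1.trans h2.symm

/-- Identification of the conditional expectations given a function of the path `Y_p`. -/
lemma ae_eq_project {p q : ℕ} (hpq : p ≤ q) {ψ : Path E q → ℝ} (hψ : IsBddMeas ψ)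
    {β : Type v} [MeasurableSpace β] {π : Path E p → β} (hπ : Measurable π) {r : β → ℝ}
    (hr : Measurable r) (hrψ : ∀ y, project K p q ψ y = r (π y)) {g : β → ℝ}
    (hg : IsCondExpGiven (chainLaw K x₀) (fun x => ψ (frestrictLe q x))
      (fun x => π (frestrictLe p x)) g) :
    (fun x => g (π (frestrictLe p x))) =ᵐ[chainLaw K x₀]
      fun x => project K p q ψ (frestrictLe p x) := by
  have hX : Measurable fun x : (k : ℕ) → E k => π (frestrictLe p x) :=
    hπ.comp (measurable_frestrictLe p)
  have hZ : IsBddMeas fun x : (k : ℕ) → E k => ψ (frestrictLe q x) :=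
    hψ.comp (measurable_frestrictLe q)
  have hP : IsBddMeas fun x : (k : ℕ) → E k => project K p q ψ (frestrictLe p x) :=
    (isBddMeas_project hψ).comp (measurable_frestrictLe p)
  refine hg.2.trans (ae_eq_condExp_of_forall_setIntegral_eq hX.comap_le (hZ.integrable _)
    (fun s _ _ => (hP.integrable _).integrableOn) ?_ ?_).symm
  · rintro _ ⟨B, hB, rfl⟩ -
    have hu : IsBddMeas (fun y => (π ⁻¹' B).indicator (fun _ => (1 : ℝ)) y) :=
      ⟨measurable_const.indicator (hπ hB), 1, fun y => by
        by_cases hy : y ∈ π ⁻¹' B <;> simp [hy]⟩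
    have e : ∀ θ : ((k : ℕ) → E k) → ℝ, ((fun x => π (frestrictLe p x)) ⁻¹' B).indicator θ =
        fun x => (π ⁻¹' B).indicator (fun _ => (1 : ℝ)) (frestrictLe p x) * θ x := by
      intro θ
      funext x
      by_cases hx : π (frestrictLe p x) ∈ B <;> simp [Set.indicator, hx]
    rw [← integral_indicator (hX hB), ← integral_indicator (hX hB), e, e]
    exact integral_mul_project K x₀ hpq hu hψ
  · simp_rw [hrψ]
    exact (hr.comp (comap_measurable _)).stronglyMeasurable.aestronglyMeasurable

end Projection

/-! ### Explicit form of the asymptotic variance. -/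

section Variance

variable {E : ℕ → Type u} [∀ p, MeasurableSpace (E p)]
  (K : (p : ℕ) → Kernel (E p) (E (p + 1))) [∀ p, IsMarkovKernel (K p)] (x₀ : E 0)
  {G : (k : ℕ) → Path E k → ℝ}

lemma gammaFlow_mul_inv {p : ℕ} (hG : ∀ k, 1 ≤ k → k < p → IsRegularPotential (G k))
    {ψ : Path E p → ℝ} (hψ : Measurable ψ) :
    gammaFlow K x₀ G p (fun y => ψ y * pathWeight (invPotential G) p y) =
      ∫ y, ψ y ∂pathLaw K x₀ p := by
  have hinv := isBddMeas_pathWeight (isRegularPotential_invPotential hG)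
  rw [gammaFlow_eq K x₀ hG (f := fun y => ψ y * pathWeight (invPotential G) p y)
    (hψ.mul hinv.measurable)]
  refine integral_congr_ae (ae_of_all _ fun y => ?_)
  have := pathWeight_mul_invPotential (fun k h1 h2 => (hG k h1 h2).pos) y
  simp only
  rw [mul_assoc, mul_comm (pathWeight (invPotential G) p y), this, mul_one]

/-- One of the two inverse weights cancels the weight in γ_p; the other is the weight of γ_p⁻. -/
lemma gammaFlow_sq_mul_inv {p : ℕ} (hG : ∀ k, 1 ≤ k → k < p → IsRegularPotential (G k))
    {ψ : Path E p → ℝ} (hψ : Measurable ψ) :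
    gammaFlow K x₀ G p (fun y => (ψ y * pathWeight (invPotential G) p y) ^ 2) =
      gammaFlow K x₀ (invPotential G) p (fun y => ψ y ^ 2) := by
  have hG' := isRegularPotential_invPotential hG
  have hinv := isBddMeas_pathWeight hG'
  rw [gammaFlow_eq K x₀ hG' (hψ.pow_const 2), ← gammaFlow_mul_inv K x₀ hG
    (ψ := fun y => ψ y ^ 2 * pathWeight (invPotential G) p y)
    ((hψ.pow_const 2).mul hinv.measurable)]
  congr 1
  funext y
  ring

/-- The inverse weight depends only on the path up to time p, so it leaves the transition, and G_p
cancels its last factor. The class of functions ψ ∏ G_k⁻ is thus preserved. -/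
lemma fkStep_mul_inv {p : ℕ} (hp : 1 ≤ p)
    (hG : ∀ k, 1 ≤ k → k < p + 1 → IsRegularPotential (G k)) (ψ : Path E (p + 1) → ℝ) :
    fkStep K G p (fun y => ψ y * pathWeight (invPotential G) (p + 1) y) =
      fun y => (∫ z, ψ z ∂histKernel K p y) * pathWeight (invPotential G) p y := by
  funext y
  have hG' := isRegularPotential_invPotential hG
  have hm : Measurable fun y => pathWeight (invPotential G) p y * invPotential G p y :=
    (isBddMeas_pathWeight fun k h1 h2 => hG' k h1 (by lia)).measurable.mul
      (hG' p hp (by lia)).measurable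
  have h := integral_histKernel_mul K hm ψ y
  simp_rw [← pathWeight_succ (invPotential G) hp] at h
  rw [fkStep]
  simp_rw [mul_comm (ψ _)]
  rw [h]
  have hGy : G p y ≠ 0 := ((hG p hp (by lia)).pos y).ne'
  rw [invPotential]
  field_simp

/-- The asymptotic variance in terms of conditional expectations. -/
lemma asympVar_mul_inv {m : ℕ} (hm : 1 ≤ m)
    (hG : ∀ k, 1 ≤ k → k < m → IsRegularPotential (G k)) {ψ : Path E m → ℝ} (hψ : IsBddMeas ψ) :
    asympVar K x₀ G m (fun y => ψ y * pathWeight (invPotential G) m y) =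
      ∑ p ∈ Finset.Icc 1 m, (gammaFlow K x₀ G p (fun _ => 1) *
        gammaFlow K x₀ (invPotential G) p (fun y => project K p m ψ y ^ 2) -
          (∫ y, ψ y ∂pathLaw K x₀ m) ^ 2) := by
  induction m, hm using Nat.le_induction with
  | base =>
    rw [Finset.Icc_self, Finset.sum_singleton, asympVar, asympVar, gammaFlow_mul_inv K x₀ hG
      hψ.measurable, gammaFlow_sq_mul_inv K x₀ hG hψ.measurable, project_self K hψ.measurable,
      add_zero]
  | succ m hm ih =>
    rw [asympVar, gammaFlow_mul_inv K x₀ hG hψ.measurable,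
      gammaFlow_sq_mul_inv K x₀ hG hψ.measurable, fkStep_mul_inv K hm hG,
      ih (fun k h1 h2 => hG k h1 (by lia)) (hψ.integral_kernel _),
      ← Finset.insert_Icc_right_eq_Icc_add_one (by lia), Finset.sum_insert (by simp),
      project_self K hψ.measurable, integral_pathLaw_succ K x₀ m hψ]
    congr 1
    refine Finset.sum_congr rfl fun p hp => ?_
    rw [project_succ K (Finset.mem_Icc.1 hp).2 hψ]

lemma mul_etaFlow {p : ℕ} (hG : ∀ k, 1 ≤ k → k < p → IsRegularPotential (G k))
    (f : Path E p → ℝ) (c : ℝ) :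
    c * gammaFlow K x₀ G p (fun _ => 1) * etaFlow K x₀ G p f = c * gammaFlow K x₀ G p f := by
  rw [etaFlow, mul_assoc, mul_div_cancel₀ _ (gammaFlow_one_pos K x₀ hG).ne']

lemma gammaFlow_congr_ae {p : ℕ} {f g : Path E p → ℝ}
    (hfg : (fun x => f (frestrictLe p x)) =ᵐ[chainLaw K x₀] fun x => g (frestrictLe p x)) :
    gammaFlow K x₀ G p f = gammaFlow K x₀ G p g := by
  refine integral_congr_ae ?_
  filter_upwards [hfg] with x hx
  rw [hx]

end Variance

/-! ### From characteristic functions to convergence in law. -/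

section Gaussian

variable {Ω : ℕ → Type*} [∀ N, MeasurableSpace (Ω N)] {μ : (N : ℕ) → Measure (Ω N)}
  [∀ N, IsProbabilityMeasure (μ N)]

/-- Lévy's criterion for the convergence in law to a centered Gaussian variable; the limit of the
characteristic functions determines the variance, which is automatically nonnegative. -/
lemma exists_tendstoInDistribution_gaussianReal {X : (N : ℕ) → Ω N → ℝ}
    (hX : ∀ N, AEMeasurable (X N) (μ N)) {s : ℝ}
    (h : ∀ t : ℝ, Tendsto (fun N => ∫ ω, Complex.exp ((t * X N ω : ℝ) * Complex.I) ∂μ N) atTop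
      (𝓝 (Complex.exp (-(t ^ 2 * s / 2 : ℝ))))) :
    ∃ v : ℝ≥0, (v : ℝ) = s ∧
      TendstoInDistribution X atTop (id : ℝ → ℝ) μ (gaussianReal 0 v) := by
  -- Characteristic functions have modulus at most 1, hence so does the limit; t = 1 suffices.
  have hs : 0 ≤ s := by
    have h1 : ‖Complex.exp (-((1 : ℝ) ^ 2 * s / 2 : ℝ))‖ ≤ 1 := by
      refine le_of_tendsto (h 1).norm (Eventually.of_forall fun N => ?_)
      refine (norm_integral_le_of_norm_le_const (C := 1) (ae_of_all _ fun ω => ?_)).trans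
        (by simp)
      rw [Complex.norm_exp_ofReal_mul_I]
    rw [← Complex.ofReal_neg, Complex.norm_exp_ofReal, Real.exp_le_one_iff] at h1
    linarith
  lift s to ℝ≥0 using hs
  refine ⟨s, rfl, hX, aemeasurable_id, ?_⟩
  refine ProbabilityMeasure.tendsto_iff_tendsto_charFun.2 fun t => ?_
  simp only [ProbabilityMeasure.coe_mk, Measure.map_id, charFun_gaussianReal]
  convert h t using 2 with N
  · rw [charFun_apply_real, integral_map (hX N) (Measurable.aestronglyMeasurable (by fun_prop))]
    push_cast
    rfl
  · congr 1
    push_cast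
    ring

end Gaussian
-- Functions restricted to the rare event.
section LevelIndicators

variable {E : ℕ → Type u} {G : (k : ℕ) → Path E k → ℝ} {n : ℕ} {V : E n → ℝ} {a : ℝ}

/-- The function `φ 1_{V ≥ a}` on paths. -/
noncomputable def restrictToLevel (V : E n → ℝ) (a : ℝ) (φ : Path E n → ℝ) (y : Path E n) : ℝ :=
  φ y * {x | a ≤ V x}.indicator (fun _ => 1) (endpoint y)

lemma weightedIndicator_eq (G : (k : ℕ) → Path E k → ℝ) (V : E n → ℝ) (a : ℝ)
    (φ : Path E n → ℝ) :
    weightedIndicator G n V a φ =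
      fun y => restrictToLevel V a φ y * pathWeight (invPotential G) n y := by
  funext y
  by_cases h : a ≤ V (endpoint y) <;> simp [weightedIndicator, restrictToLevel, h]

lemma restrictToLevel_frestrictLe (φ : Path E n → ℝ) :
    (fun x => restrictToLevel V a φ (frestrictLe n x)) =
      {x : (p : ℕ) → E p | a ≤ V (x n)}.indicator fun x => φ (frestrictLe n x) := by
  funext x
  have : endpoint (frestrictLe n x) = x n := rfl
  by_cases h : a ≤ V (x n) <;> simp [restrictToLevel, this, h]

lemma weightedIndicator_sub_const (G : (k : ℕ) → Path E k → ℝ) (φ : Path E n → ℝ) (c : ℝ)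
    (y : Path E n) :
    weightedIndicator G n V a (fun y => φ y - c) y =
      weightedIndicator G n V a φ y - c * weightedIndicator G n V a (fun _ => 1) y := by
  simp only [weightedIndicator]
  ring

lemma gammaEst_weightedIndicator_sub_const (φ : Path E n → ℝ) (c : ℝ) {N : ℕ} {Ω : Type v}
    (ξ : (p : ℕ) → Ω → Fin N → Path E p) (ω : Ω) :
    gammaEst G n (weightedIndicator G n V a (fun y => φ y - c)) ξ ω =
      gammaEst G n (weightedIndicator G n V a φ) ξ ω -
        c * gammaEst G n (weightedIndicator G n V a (fun _ => 1)) ξ ω := by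
  simp only [gammaEst, empMean, weightedIndicator_sub_const, Finset.sum_sub_distrib,
    ← Finset.mul_sum]
  ring

end LevelIndicators

section RareEvents

variable {E : ℕ → Type u} [∀ p, MeasurableSpace (E p)]
  (K : (p : ℕ) → Kernel (E p) (E (p + 1))) [∀ p, IsMarkovKernel (K p)] (x₀ : E 0)
  {G : (k : ℕ) → Path E k → ℝ} {n : ℕ} {V : E n → ℝ} {a : ℝ}

lemma isBddMeas_indicator_level (hV : Measurable V) (a : ℝ) :
    IsBddMeas ({x | a ≤ V x}.indicator fun _ => (1 : ℝ)) :=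
  ⟨measurable_const.indicator (measurableSet_le measurable_const hV), 1, fun x => by
    by_cases h : a ≤ V x <;> simp [h]⟩

lemma isBddMeas_restrictToLevel (hV : Measurable V) (a : ℝ) {φ : Path E n → ℝ}
    (hφ : IsBddMeas φ) : IsBddMeas (restrictToLevel V a φ) :=
  hφ.mul ((isBddMeas_indicator_level hV a).comp (measurable_endpoint n))

lemma isBddMeas_weightedIndicator (hV : Measurable V) (a : ℝ)
    (hG : ∀ k, 1 ≤ k → k < n → IsRegularPotential (G k)) {φ : Path E n → ℝ} (hφ : IsBddMeas φ) :
    IsBddMeas (weightedIndicator G n V a φ) := by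
  rw [weightedIndicator_eq]
  exact (isBddMeas_restrictToLevel hV a hφ).mul
    (isBddMeas_pathWeight (isRegularPotential_invPotential hG))

lemma measurableSet_level (hV : Measurable V) (a : ℝ) :
    MeasurableSet {x : (p : ℕ) → E p | a ≤ V (x n)} :=
  measurableSet_le measurable_const (hV.comp (measurable_pi_apply n))

lemma integral_restrictToLevel (hV : Measurable V) {φ : Path E n → ℝ} (hφ : IsBddMeas φ) :
    ∫ y, restrictToLevel V a φ y ∂pathLaw K x₀ n =
      ∫ x in {x | a ≤ V (x n)}, φ (frestrictLe n x) ∂chainLaw K x₀ := by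
  rw [← integral_chainLaw K x₀ (isBddMeas_restrictToLevel hV a hφ).measurable,
    restrictToLevel_frestrictLe, integral_indicator (measurableSet_level hV a)]

lemma integral_restrictToLevel_one (hV : Measurable V) :
    ∫ y, restrictToLevel V a (fun _ => 1) y ∂pathLaw K x₀ n = rareProb K x₀ n V a := by
  rw [integral_restrictToLevel K x₀ hV (IsBddMeas.const 1)]
  simp [rareProb]

lemma setIntegral_eq_mul_rareMean (ha : 0 < rareProb K x₀ n V a) (φ : Path E n → ℝ) :
    ∫ x in {x | a ≤ V (x n)}, φ (frestrictLe n x) ∂chainLaw K x₀ =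
      rareProb K x₀ n V a * rareMean K x₀ n V a φ := by
  rw [rareMean, ProbabilityTheory.cond, integral_smul_measure, ENNReal.toReal_inv, smul_eq_mul,
    ← mul_assoc]
  change _ = rareProb K x₀ n V a * (rareProb K x₀ n V a)⁻¹ * _
  rw [mul_inv_cancel₀ ha.ne', one_mul]

/-- Subtracting the conditional mean centers φ on the event. This is why no squared mean is
subtracted in the variance of the ratio. -/
lemma integral_restrictToLevel_centered (hV : Measurable V) (ha : 0 < rareProb K x₀ n V a)
    {φ : Path E n → ℝ} (hφ : IsBddMeas φ) :
    ∫ y, restrictToLevel V a (fun y => φ y - rareMean K x₀ n V a φ) y ∂pathLaw K x₀ n = 0 := by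
  rw [integral_restrictToLevel K x₀ hV (hφ.sub (IsBddMeas.const _))]
  rw [integral_sub
    ((hφ.comp (measurable_frestrictLe n)).integrable _) (integrable_const _),
    setIntegral_eq_mul_rareMean K x₀ ha]
  simp [rareProb]

/-- The product of the η_q^N(G_q) is positive and cancels. The identity survives a vanishing
denominator, where both quotients are 0. -/
lemma condEstimator_eq (hG : ∀ k, 1 ≤ k → k < n → IsRegularPotential (G k)) {N : ℕ} (hN : 1 ≤ N)
    (φ : Path E n → ℝ) {Ω : Type v} (ξ : (p : ℕ) → Ω → Fin N → Path E p) (ω : Ω) :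
    condEstimator G n V a φ ξ ω =
      gammaEst G n (weightedIndicator G n V a φ) ξ ω /
        gammaEst G n (weightedIndicator G n V a (fun _ => 1)) ξ ω := by
  have hpos : 0 < ∏ q ∈ Finset.Ico 1 n, empMean (ξ q ω) (G q) :=
    Finset.prod_pos fun q hq =>
      empMean_pos hN _ (hG q (Finset.mem_Ico.1 hq).1 (Finset.mem_Ico.1 hq).2).pos
  rw [condEstimator, gammaEst, gammaEst, mul_div_mul_right _ _ hpos.ne']

end RareEvents

/-! ### Linearization and central limit theorem for the ratio estimator. -/

section RatioBound

lemma norm_cexp_mul_I_sub_le (x y : ℝ) :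
    ‖Complex.exp ((x : ℝ) * Complex.I) - Complex.exp ((y : ℝ) * Complex.I)‖ ≤ |x - y| := by
  have e : Complex.exp ((x : ℝ) * Complex.I) - Complex.exp ((y : ℝ) * Complex.I) =
      Complex.exp ((y : ℝ) * Complex.I) * (Complex.exp (Complex.I * ((x - y : ℝ) : ℂ)) - 1) := by
    rw [mul_sub, ← Complex.exp_add, mul_one]
    congr 2
    push_cast
    ring
  rw [e, norm_mul, Complex.norm_exp_ofReal_mul_I, one_mul]
  exact Real.norm_exp_I_mul_ofReal_sub_one_le

/-- Comparison of a ratio `w / d` with its linearization when `d` is close to `P`. -/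
lemma norm_cexp_ratio_sub_le {P : ℝ} (hP : 0 < P) (t m w d q : ℝ) (hq : 0 ≤ q) :
    ‖Complex.exp ((t * (q * (w / d - m)) : ℝ) * Complex.I) -
        Complex.exp ((t / P * (q * (w - m * d)) : ℝ) * Complex.I)‖ ≤
      8 / P ^ 2 * (d - P) ^ 2 + |t| * q / P ^ 2 * ((w - m * d) ^ 2 + (d - P) ^ 2) := by
  have hR : 0 ≤ |t| * q / P ^ 2 * ((w - m * d) ^ 2 + (d - P) ^ 2) := by positivity
  rcases le_or_gt (P / 2) |d - P| with h | h
  -- Away from P, including d = 0, the trivial bound 2 is absorbed by (8/P²)(d - P)², which explains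
  -- the constant 8.
  · have h1 : ‖Complex.exp ((t * (q * (w / d - m)) : ℝ) * Complex.I) -
        Complex.exp ((t / P * (q * (w - m * d)) : ℝ) * Complex.I)‖ ≤ 2 := by
      refine (norm_sub_le _ _).trans ?_
      rw [Complex.norm_exp_ofReal_mul_I, Complex.norm_exp_ofReal_mul_I]
      norm_num
    have h2 : (P / 2) ^ 2 ≤ (d - P) ^ 2 := by
      rw [← sq_abs (d - P)]
      exact pow_le_pow_left₀ (by positivity) h 2
    have h3 : 8 / P ^ 2 * (P / 2) ^ 2 = 2 := by field_simp; norm_num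
    have h4 : 8 / P ^ 2 * (P / 2) ^ 2 ≤ 8 / P ^ 2 * (d - P) ^ 2 := by gcongr
    linarith
  · have hd : P / 2 < d := by linarith [(abs_lt.1 h).1]
    have hd0 : 0 < d := by linarith
    have hL : 0 ≤ 8 / P ^ 2 * (d - P) ^ 2 := by positivity
    refine (norm_cexp_mul_I_sub_le _ _).trans ?_
    -- The linearization error is a product of two small quantities, hence is controlled by their
    -- squares; d > P/2 bounds the denominator.
    have e : t * (q * (w / d - m)) - t / P * (q * (w - m * d)) =
        t * q / P * ((w - m * d) * (P - d) / d) := by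
      field_simp
    have h5 : |(w - m * d) * (P - d) / d| ≤ ((w - m * d) ^ 2 + (d - P) ^ 2) / P := by
      rw [abs_div, abs_of_pos hd0, abs_mul, div_le_div_iff₀ hd0 hP]
      have h6 : |w - m * d| * |P - d| * 2 ≤ (w - m * d) ^ 2 + (d - P) ^ 2 := by
        rw [← sq_abs (w - m * d), ← sq_abs (d - P), abs_sub_comm P d]
        nlinarith [sq_nonneg (|w - m * d| - |d - P|)]
      have h7 : 0 ≤ |w - m * d| * |P - d| := by positivity
      nlinarith
    rw [e, abs_mul, abs_div, abs_mul, abs_of_nonneg hq, abs_of_pos hP]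
    calc |t| * q / P * |(w - m * d) * (P - d) / d|
        ≤ |t| * q / P * (((w - m * d) ^ 2 + (d - P) ^ 2) / P) := by gcongr
      _ = |t| * q / P ^ 2 * ((w - m * d) ^ 2 + (d - P) ^ 2) := by field_simp
      _ ≤ _ := le_add_of_nonneg_left hL

end RatioBound

section Ratio

variable {E : ℕ → Type u} [∀ p, MeasurableSpace (E p)]
  (K : (p : ℕ) → Kernel (E p) (E (p + 1))) (x₀ : E 0)
  {G : (k : ℕ) → Path E k → ℝ} {n : ℕ} {V : E n → ℝ} {a : ℝ}

lemma IsParticleModel.measurable_condEstimator {N : ℕ} {Ω : Type v} [MeasurableSpace Ω]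
    {μ : Measure Ω} {ξ : (p : ℕ) → Ω → Fin N → Path E p}
    (h : IsParticleModel K x₀ G n N μ ξ) (hn : 1 ≤ n) (hV : Measurable V)
    (hG : ∀ k, 1 ≤ k → k < n → IsRegularPotential (G k)) {φ : Path E n → ℝ} (hφ : IsBddMeas φ) :
    Measurable (condEstimator G n V a φ ξ) :=
  ((isBddMeas_empMean (isBddMeas_weightedIndicator hV a hG hφ)).measurable.comp
    (h.measurable n hn le_rfl)).div
  ((isBddMeas_empMean (isBddMeas_weightedIndicator hV a hG (IsBddMeas.const 1))).measurable.comp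
    (h.measurable n hn le_rfl))

end Ratio

section RatioLimit

variable {E : ℕ → Type u} [∀ p, MeasurableSpace (E p)]
  (K : (p : ℕ) → Kernel (E p) (E (p + 1))) [∀ p, IsMarkovKernel (K p)] (x₀ : E 0)
  {G : (k : ℕ) → Path E k → ℝ} {n : ℕ} {V : E n → ℝ} {a : ℝ}
  {Ω : ℕ → Type v} [∀ N, MeasurableSpace (Ω N)] {μ : (N : ℕ) → Measure (Ω N)}
  [∀ N, IsProbabilityMeasure (μ N)] {ξ : (N : ℕ) → (p : ℕ) → Ω N → Fin N → Path E p}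

/-- Central limit theorem for the ratio estimator, at the level of characteristic functions. -/
lemma tendsto_integral_cexp_condEstimator
    (hξ : ∀ N, 1 ≤ N → IsParticleModel K x₀ G n N (μ N) (ξ N)) (hn : 1 ≤ n)
    (hG : ∀ k, 1 ≤ k → k < n → IsRegularPotential (G k)) (hV : Measurable V)
    (ha : 0 < rareProb K x₀ n V a) {φ : Path E n → ℝ} (hφ : IsBddMeas φ) (t : ℝ) :
    Tendsto (fun N : ℕ => ∫ ω, Complex.exp ((t * (√N *
        (condEstimator G n V a φ (ξ N) ω - rareMean K x₀ n V a φ)) : ℝ) * Complex.I) ∂μ N) atTop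
      (𝓝 (Complex.exp (-(t ^ 2 * ((rareProb K x₀ n V a ^ 2)⁻¹ * asympVar K x₀ G n
        (weightedIndicator G n V a fun y => φ y - rareMean K x₀ n V a φ)) / 2 : ℝ)))) := by
  set P := rareProb K x₀ n V a with hPdef
  set m := rareMean K x₀ n V a φ with hm
  have hT1 := isBddMeas_weightedIndicator hV a hG (IsBddMeas.const (F := Path E n) 1)
  have hTc := isBddMeas_weightedIndicator hV a hG (hφ.sub (IsBddMeas.const m))
  have hγ1 : gammaFlow K x₀ G n (weightedIndicator G n V a fun _ => 1) = P := by
    rw [weightedIndicator_eq, gammaFlow_mul_inv K x₀ hG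
      (isBddMeas_restrictToLevel hV a (IsBddMeas.const 1)).measurable,
      integral_restrictToLevel_one K x₀ hV]
  have hγc : gammaFlow K x₀ G n (weightedIndicator G n V a fun y => φ y - m) = 0 := by
    rw [weightedIndicator_eq, gammaFlow_mul_inv K x₀ hG
      (isBddMeas_restrictToLevel hV a (hφ.sub (IsBddMeas.const m))).measurable,
      integral_restrictToLevel_centered K x₀ hV ha hφ]
  obtain ⟨C, hC0, hC⟩ := exists_integral_sq_gammaEst_sub_le K x₀ hξ hG hn le_rfl hT1
  obtain ⟨D, hD0, hD⟩ := exists_integral_sq_gammaEst_sub_le K x₀ hξ hG hn le_rfl hTc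
  have hlim := tendsto_integral_cexp_gammaEst K x₀ hξ hG hn le_rfl hTc (t / P)
  rw [hγ1] at hC
  rw [hγc] at hD hlim
  simp only [sub_zero] at hD hlim
  have hvar : ∀ s : ℝ, (t / P) ^ 2 * s / 2 = t ^ 2 * ((P ^ 2)⁻¹ * s) / 2 := fun s => by
    rw [div_pow]; ring
  rw [hvar] at hlim
  refine (tendsto_iff_of_dist ?_).2 hlim
  refine squeeze_zero_norm' ?_
    (tendsto_const_div_sqrt (8 / P ^ 2 * C + |t| / P ^ 2 * (D + C)))
  filter_upwards [eventually_ge_atTop 1] with N hN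
  have hN1 : (1 : ℝ) ≤ N := by exact_mod_cast hN
  have hs : 0 < √(N : ℝ) := Real.sqrt_pos.2 (by linarith)
  have hs1 : 1 ≤ √(N : ℝ) := Real.one_le_sqrt.2 hN1
  have hss : (N : ℝ) = √N * √N := (Real.mul_self_sqrt (Nat.cast_nonneg N)).symm
  have hb1 := (hξ N hN).isBddMeas_gammaEst hn le_rfl hG hT1
  have hbc := (hξ N hN).isBddMeas_gammaEst hn le_rfl hG hTc
  have hmeas := ((hξ N hN).measurable_condEstimator K x₀ (a := a) hn hV hG hφ).sub_const m
  have hmc := hbc.measurable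
  have i1 := ((hb1.sub (IsBddMeas.const P)).pow 2).integrable (μ N)
  have i2 := (hbc.pow 2).integrable (μ N)
  have i3 : Integrable (fun ω =>
      gammaEst G n (weightedIndicator G n V a fun y => φ y - m) (ξ N) ω ^ 2 +
        (gammaEst G n (weightedIndicator G n V a fun _ => 1) (ξ N) ω - P) ^ 2) (μ N) := i2.add i1
  rw [Real.norm_of_nonneg dist_nonneg, dist_eq_norm, ← integral_sub]
  · refine (norm_integral_le_integral_norm _).trans ?_
    calc _ ≤ ∫ ω, (8 / P ^ 2 *
            (gammaEst G n (weightedIndicator G n V a fun _ => 1) (ξ N) ω - P) ^ 2 +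
          |t| * √N / P ^ 2 *
            (gammaEst G n (weightedIndicator G n V a fun y => φ y - m) (ξ N) ω ^ 2 +
            (gammaEst G n (weightedIndicator G n V a fun _ => 1) (ξ N) ω - P) ^ 2)) ∂μ N := by
          refine integral_mono_of_nonneg (ae_of_all _ fun ω => norm_nonneg _)
            ((i1.const_mul _).add (i3.const_mul _)) (ae_of_all _ fun ω => ?_)
          simp only
          rw [condEstimator_eq hG hN, gammaEst_weightedIndicator_sub_const]
          exact norm_cexp_ratio_sub_le ha t m _ _ _ hs.le
      _ ≤ 8 / P ^ 2 * (C / N) + |t| * √N / P ^ 2 * (D / N + C / N) := by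
          rw [integral_add (i1.const_mul _) (i3.const_mul _), integral_const_mul,
            integral_const_mul, integral_add i2 i1]
          have := hC N hN
          have := hD N hN
          gcongr
      -- The factor q = √N in the linearization bound meets second moments of order 1/N, so the
      -- total is still O(1/√N).
      _ = 8 / P ^ 2 * C / √N / √N + |t| / P ^ 2 * (D + C) / √N := by
          rw [hss, Real.sqrt_mul_self hs.le]
          field_simp
      _ ≤ 8 / P ^ 2 * C / √N + |t| / P ^ 2 * (D + C) / √N := by
          gcongr
          exact div_le_self (by positivity) hs1
      _ = _ := by rw [add_div]
  · have : Measurable fun ω => t * (√N * (condEstimator G n V a φ (ξ N) ω - m)) :=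
      (hmeas.const_mul _).const_mul t
    refine Integrable.of_bound (Measurable.aestronglyMeasurable (by fun_prop)) 1
      (ae_of_all _ fun ω => ?_)
    rw [Complex.norm_exp_ofReal_mul_I]
  · refine Integrable.of_bound (Measurable.aestronglyMeasurable (by fun_prop)) 1
      (ae_of_all _ fun ω => ?_)
    rw [Complex.norm_exp_ofReal_mul_I]

end RatioLimit

end RareEvent

/-! ### The theorem. -/

theorem theorem2p3
    -- a Markov chain `X` with `X_0 = x₀` and transitions `K`, in measurable spaces `E p`
    {E : ℕ → Type*} [∀ p, MeasurableSpace (E p)]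
    (K : (p : ℕ) → Kernel (E p) (E (p + 1))) [∀ p, IsMarkovKernel (K p)] (x₀ : E 0)
    -- the horizon, the energy function, the level and the potentials
    (n : ℕ) (hn : 1 ≤ n) (V : E n → ℝ) (hV : Measurable V) (a : ℝ)
    (ha : 0 < RareEvent.rareProb K x₀ n V a)
    (G : (k : ℕ) → RareEvent.Path E k → ℝ)
    (hG : ∀ k, 1 ≤ k → k < n → RareEvent.IsRegularPotential (G k))
    -- for every `N ≥ 1` a realization of the `N`-particle model
    {Ω : ℕ → Type*} [∀ N, MeasurableSpace (Ω N)] (μ : (N : ℕ) → Measure (Ω N))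
    [∀ N, IsProbabilityMeasure (μ N)]
    (ξ : (N : ℕ) → (p : ℕ) → Ω N → Fin N → RareEvent.Path E p)
    (hξ : ∀ N, 1 ≤ N → RareEvent.IsParticleModel K x₀ G n N (μ N) (ξ N)) :
    -- unbiasedness
    (∀ N, 1 ≤ N →
      Integrable (RareEvent.probEstimator G n V a (ξ N)) (μ N) ∧
      ∫ ω, RareEvent.probEstimator G n V a (ξ N) ω ∂(μ N) = RareEvent.rareProb K x₀ n V a) ∧
    -- central limit theorem for `P_n^N(a)`
    (∀ g : (p : ℕ) → E p → ℝ,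
      (∀ p, 1 ≤ p → p ≤ n →
        RareEvent.IsCondExpGiven (RareEvent.chainLaw K x₀)
          (Set.indicator {x | a ≤ V (x n)} (fun _ => (1 : ℝ))) (fun x => x p) (g p)) →
      ∃ v : ℝ≥0,
        (v : ℝ) = ∑ p ∈ Finset.Icc 1 n,
          (RareEvent.gammaFlow K x₀ G p (fun _ => 1) *
              RareEvent.gammaFlow K x₀ (RareEvent.invPotential G) p (fun _ => 1) *
              RareEvent.etaFlow K x₀ (RareEvent.invPotential G) p
                (fun y => g p (RareEvent.endpoint y) ^ 2) -
            RareEvent.rareProb K x₀ n V a ^ 2) ∧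
        TendstoInDistribution
          (fun (N : ℕ) (ω : Ω N) => √(N : ℝ) *
            (RareEvent.probEstimator G n V a (ξ N) ω - RareEvent.rareProb K x₀ n V a))
          atTop (id : ℝ → ℝ) μ (gaussianReal 0 v)) ∧
    -- central limit theorem for `P_n^N(a, φ)`
    (∀ φ : RareEvent.Path E n → ℝ, Measurable φ → (∃ C : ℝ, ∀ y, |φ y| ≤ C) →
      ∀ h : (p : ℕ) → RareEvent.Path E p → ℝ,
      (∀ p, 1 ≤ p → p ≤ n →
        RareEvent.IsCondExpGiven (RareEvent.chainLaw K x₀)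
          (Set.indicator {x | a ≤ V (x n)}
            (fun x => φ (frestrictLe n x) - RareEvent.rareMean K x₀ n V a φ))
          (frestrictLe p) (h p)) →
      ∃ v : ℝ≥0,
        (v : ℝ) = (RareEvent.rareProb K x₀ n V a ^ 2)⁻¹ * ∑ p ∈ Finset.Icc 1 n,
          RareEvent.gammaFlow K x₀ G p (fun _ => 1) *
            RareEvent.gammaFlow K x₀ (RareEvent.invPotential G) p (fun _ => 1) *
            RareEvent.etaFlow K x₀ (RareEvent.invPotential G) p (fun y => h p y ^ 2) ∧
        TendstoInDistribution
          (fun (N : ℕ) (ω : Ω N) => √(N : ℝ) *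
            (RareEvent.condEstimator G n V a φ (ξ N) ω - RareEvent.rareMean K x₀ n V a φ))
          atTop (id : ℝ → ℝ) μ (gaussianReal 0 v)) := by
  have hT1 := RareEvent.isBddMeas_weightedIndicator hV a hG
    (RareEvent.IsBddMeas.const (F := RareEvent.Path E n) 1)
  have hI1 := RareEvent.isBddMeas_restrictToLevel hV a
    (RareEvent.IsBddMeas.const (F := RareEvent.Path E n) 1)
  have hγ1 : RareEvent.gammaFlow K x₀ G n (RareEvent.weightedIndicator G n V a fun _ => 1) =
      RareEvent.rareProb K x₀ n V a := by
    rw [RareEvent.weightedIndicator_eq, RareEvent.gammaFlow_mul_inv K x₀ hG hI1.measurable,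
      RareEvent.integral_restrictToLevel_one K x₀ hV]
  refine ⟨fun N hN => ⟨?_, ?_⟩, fun g hg => ?_, fun φ hφm hφb h hh => ?_⟩
  · exact ((hξ N hN).isBddMeas_gammaEst hn le_rfl hG hT1).integrable _
  · rw [← hγ1]
    exact (hξ N hN).integral_gammaEst hG hN hn le_rfl hT1
  · have hvar : ∑ p ∈ Finset.Icc 1 n,
          (RareEvent.gammaFlow K x₀ G p (fun _ => 1) *
              RareEvent.gammaFlow K x₀ (RareEvent.invPotential G) p (fun _ => 1) *
              RareEvent.etaFlow K x₀ (RareEvent.invPotential G) p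
                (fun y => g p (RareEvent.endpoint y) ^ 2) -
            RareEvent.rareProb K x₀ n V a ^ 2) =
        RareEvent.asympVar K x₀ G n (RareEvent.weightedIndicator G n V a fun _ => 1) := by
      rw [RareEvent.weightedIndicator_eq, RareEvent.asympVar_mul_inv K x₀ hn hG hI1,
        RareEvent.integral_restrictToLevel_one K x₀ hV]
      refine Finset.sum_congr rfl fun p hp => ?_
      obtain ⟨hp1, hpn⟩ := Finset.mem_Icc.1 hp
      have hG' := RareEvent.isRegularPotential_invPotential
        (fun k h1 h2 => hG k h1 (h2.trans_le hpn) : ∀ k, 1 ≤ k → k < p → _)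
      rw [RareEvent.mul_etaFlow K x₀ hG']
      congr 2
      refine RareEvent.gammaFlow_congr_ae K x₀ ?_
      -- The given version g is conditional on X_p only; by the Markov property it agrees almost
      -- surely with the conditional expectation given the path, and γ_p⁻ sees only almost sure
      -- classes.
      obtain ⟨r, hr, hrψ⟩ := RareEvent.exists_project_endpoint K hpn
        (RareEvent.isBddMeas_indicator_level hV a)
      have hψ : RareEvent.restrictToLevel V a (fun _ => 1) = fun z : RareEvent.Path E n =>
          {x | a ≤ V x}.indicator (fun _ => (1 : ℝ)) (RareEvent.endpoint z) := by
        funext z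
        rw [RareEvent.restrictToLevel, one_mul]
      rw [← hψ] at hrψ
      have hgp := hg p hp1 hpn
      rw [← RareEvent.restrictToLevel_frestrictLe (fun _ => 1)] at hgp
      filter_upwards [RareEvent.ae_eq_project K x₀ hpn hI1 (RareEvent.measurable_endpoint p) hr hrψ
        hgp] with x hx
      rw [hx]
    rw [hvar]
    refine RareEvent.exists_tendstoInDistribution_gaussianReal (fun N => ?_) fun t => ?_
    -- At N = 0 no particle model is assumed, but the factor √0 makes the variable constant.
    · rcases Nat.eq_zero_or_pos N with rfl | hN
      · simp
      · exact ((((hξ N hN).isBddMeas_gammaEst hn le_rfl hG hT1).measurable.sub_const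
          _).const_mul _).aemeasurable
    · have := RareEvent.tendsto_integral_cexp_gammaEst K x₀ hξ hG hn le_rfl hT1 t
      rwa [hγ1] at this
  · have hφ : RareEvent.IsBddMeas φ := ⟨hφm, hφb⟩
    have hIc := RareEvent.isBddMeas_restrictToLevel hV a
      (hφ.sub (RareEvent.IsBddMeas.const (RareEvent.rareMean K x₀ n V a φ)))
    have hvar : ∑ p ∈ Finset.Icc 1 n,
          RareEvent.gammaFlow K x₀ G p (fun _ => 1) *
            RareEvent.gammaFlow K x₀ (RareEvent.invPotential G) p (fun _ => 1) *
            RareEvent.etaFlow K x₀ (RareEvent.invPotential G) p (fun y => h p y ^ 2) =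
        RareEvent.asympVar K x₀ G n (RareEvent.weightedIndicator G n V a
          fun y => φ y - RareEvent.rareMean K x₀ n V a φ) := by
      rw [RareEvent.weightedIndicator_eq, RareEvent.asympVar_mul_inv K x₀ hn hG hIc,
        RareEvent.integral_restrictToLevel_centered K x₀ hV ha hφ]
      refine Finset.sum_congr rfl fun p hp => ?_
      obtain ⟨hp1, hpn⟩ := Finset.mem_Icc.1 hp
      have hG' := RareEvent.isRegularPotential_invPotential
        (fun k h1 h2 => hG k h1 (h2.trans_le hpn) : ∀ k, 1 ≤ k → k < p → _)
      rw [RareEvent.mul_etaFlow K x₀ hG', zero_pow two_ne_zero, sub_zero]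
      congr 1
      refine RareEvent.gammaFlow_congr_ae K x₀ ?_
      have hhp := hh p hp1 hpn
      rw [← RareEvent.restrictToLevel_frestrictLe
        (fun y => φ y - RareEvent.rareMean K x₀ n V a φ)] at hhp
      -- Here the conditioning is on the whole path, so the conditioning map is the identity and no
      -- Markov property is needed.
      filter_upwards [RareEvent.ae_eq_project K x₀ hpn hIc measurable_id
        (RareEvent.isBddMeas_project hIc).measurable (fun _ => rfl) hhp] with x hx
      exact congrArg (· ^ 2) hx
    rw [hvar]
    refine RareEvent.exists_tendstoInDistribution_gaussianReal (fun N => ?_)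
      (RareEvent.tendsto_integral_cexp_condEstimator K x₀ hξ hn hG hV ha hφ)
    rcases Nat.eq_zero_or_pos N with rfl | hN
    · simp
    · exact ((((hξ N hN).measurable_condEstimator K x₀ hn hV hG hφ).sub_const
        _).const_mul _).aemeasurable
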